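/- Let $n\ge 2$ be an integer, let $\Omega\subset\mathbb R^n$ be a bounded domain (a bounded, non-empty, connected open set), and let $h\colon\mathbb R\to\mathbb R$ be continuous. For a matrix $A\in\mathbb R^{n\times n}$ let $\operatorname{cof}A$ denote its cofactor matrix, so that $A^T\operatorname{cof}A=(\operatorname{cof}A)A^T=(\det A)I$, and write $A:B=\sum_{i,j}A^i_jB^i_j$. A function $u\in W^{1,1}_{loc}(\Omega;\mathbb R^n)$ with weak Jacobian matrix $Du=(\partial u^i/\partial x_j)$ is called a weak solution of $$\operatorname{div}\bigl(h(\det Du)\operatorname{cof}Du\bigr)=0\quad\text{in }\Omega$$ if $h(\det Du)\operatorname{cof}Du\in L^1_{loc}(\Omega;\mathbb R^{n\times n})$ and $$\int_\Omega h(\det Du)\operatorname{cof}Du:D\zeta\,dx=0\qquad\text{for all }\zeta\in C^1_c(\Omega;\mathbb R^n).$$ Let $u$ be a weak solution of this equation. Then $\det Du$ is constant almost everywhere on $\Omega$ if one of the following assumptions holds: (a) $u\in C^1(\Omega;\mathbb R^n)$, and $h$ is not constant on any non-degenerate interval; (b) $u\in W^{1,p}_{loc}(\Omega;\mathbb R^n)$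 and $h(\det Du)\in W^{1,\bar p}_{loc}(\Omega)$ for some $p$ with $n-1\le p\le\infty$ and $\bar p=\frac{p}{p+1-n}$ (with $\bar p=\infty$ if $p=n-1$, and $\bar p=1$ if $p=\infty$), and $h$ is one-to-one. -/

import Mathlib

open MeasureTheory
open scoped ENNReal ContDiff

namespace DetEL

/-- The partial derivative `∂f/∂x_j` (in the classical sense) of a scalar function on `ℝⁿ`. -/
noncomputable def partialDeriv {n : ℕ} (j : Fin n) (f : EuclideanSpace ℝ (Fin n) → ℝ)
    (x : EuclideanSpace ℝ (Fin n)) : ℝ :=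
  fderiv ℝ f x (EuclideanSpace.single j 1)

/-- `f ∈ L^p_loc(Ω)`: `f` is in `L^p` on every compact subset of `Ω`. -/
def MemLpLoc {n : ℕ} (Ω : Set (EuclideanSpace ℝ (Fin n))) (p : ℝ≥0∞)
    (f : EuclideanSpace ℝ (Fin n) → ℝ) : Prop :=
  ∀ K : Set (EuclideanSpace ℝ (Fin n)), IsCompact K → K ⊆ Ω → MemLp f p (volume.restrict K)

/-- `g` is the weak partial derivative of `f` in the direction `x_j` on the open set `Ω`:
both are in `L^1_loc(Ω)`, and `∫_Ω f ∂_j φ = - ∫_Ω g φ` for all `φ ∈ C_c^∞(Ω)`. -/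
structure IsWeakPartialDeriv {n : ℕ} (Ω : Set (EuclideanSpace ℝ (Fin n))) (j : Fin n)
    (f g : EuclideanSpace ℝ (Fin n) → ℝ) : Prop where
  memLpLoc_fun : MemLpLoc Ω 1 f
  memLpLoc_deriv : MemLpLoc Ω 1 g
  integral_eq : ∀ φ : EuclideanSpace ℝ (Fin n) → ℝ,
    ContDiff ℝ ∞ φ → HasCompactSupport φ → tsupport φ ⊆ Ω →
      ∫ x in Ω, f x * partialDeriv j φ x = - ∫ x in Ω, g x * φ x

/-- `f ∈ W^{1,p}_loc(Ω)`, for a scalar function `f` and an exponent `1 ≤ p ≤ ∞`. -/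
def MemW1Loc {n : ℕ} (Ω : Set (EuclideanSpace ℝ (Fin n))) (p : ℝ≥0∞)
    (f : EuclideanSpace ℝ (Fin n) → ℝ) : Prop :=
  MemLpLoc Ω p f ∧
    ∀ j : Fin n, ∃ g : EuclideanSpace ℝ (Fin n) → ℝ, MemLpLoc Ω p g ∧ IsWeakPartialDeriv Ω j f g

/-- `u ∈ W^{1,p}_loc(Ω; ℝⁿ)`: every component of `u` is in `W^{1,p}_loc(Ω)`. -/
def MemW1LocVec {n : ℕ} (Ω : Set (EuclideanSpace ℝ (Fin n))) (p : ℝ≥0∞)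
    (u : EuclideanSpace ℝ (Fin n) → EuclideanSpace ℝ (Fin n)) : Prop :=
  ∀ i : Fin n, MemW1Loc Ω p (fun x => u x i)

/-- `Du` is (a representative of) the weak Jacobian matrix of `u` on `Ω`:
`(Du)^i_j = ∂u^i/∂x_j` in the weak sense. It is determined by `u` almost everywhere on `Ω`. -/
def IsWeakJacobian {n : ℕ} (Ω : Set (EuclideanSpace ℝ (Fin n)))
    (u : EuclideanSpace ℝ (Fin n) → EuclideanSpace ℝ (Fin n))
    (Du : EuclideanSpace ℝ (Fin n) → Matrix (Fin n) (Fin n) ℝ) : Prop :=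
  ∀ i j : Fin n, IsWeakPartialDeriv Ω j (fun x => u x i) (fun x => Du x i j)

/-- The classical Jacobian matrix `(Dζ)^i_j = ∂ζ^i/∂x_j`. -/
noncomputable def jacobian {n : ℕ} (ζ : EuclideanSpace ℝ (Fin n) → EuclideanSpace ℝ (Fin n))
    (x : EuclideanSpace ℝ (Fin n)) : Matrix (Fin n) (Fin n) ℝ :=
  Matrix.of fun i j => partialDeriv j (fun y => ζ y i) x

/-- The cofactor matrix, normalized by `Aᵀ * cof A = cof A * Aᵀ = det A • 1`. -/
def cof {n : ℕ} (A : Matrix (Fin n) (Fin n) ℝ) : Matrix (Fin n) (Fin n) ℝ :=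
  (Matrix.adjugate A).transpose

/-- The inner product `A : B = ∑ A^i_j B^i_j` of matrices. -/
def frob {n : ℕ} (A B : Matrix (Fin n) (Fin n) ℝ) : ℝ :=
  ∑ i, ∑ j, A i j * B i j

/-- `u`, with weak Jacobian matrix `Du`, is a weak solution of
`div (h(det Du) cof Du) = 0` in `Ω`. -/
structure IsWeakSolution {n : ℕ} (Ω : Set (EuclideanSpace ℝ (Fin n))) (h : ℝ → ℝ)
    (u : EuclideanSpace ℝ (Fin n) → EuclideanSpace ℝ (Fin n))
    (Du : EuclideanSpace ℝ (Fin n) → Matrix (Fin n) (Fin n) ℝ) : Prop where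
  memW1Loc : MemW1LocVec Ω 1 u
  isWeakJacobian : IsWeakJacobian Ω u Du
  memLpLoc_flux : ∀ i j : Fin n, MemLpLoc Ω 1 (fun x => (h (Du x).det • cof (Du x)) i j)
  integral_eq_zero : ∀ ζ : EuclideanSpace ℝ (Fin n) → EuclideanSpace ℝ (Fin n),
    ContDiff ℝ 1 ζ → HasCompactSupport ζ → tsupport ζ ⊆ Ω →
      ∫ x in Ω, frob (h (Du x).det • cof (Du x)) (jacobian ζ x) = 0

/-- The exponent `p / (p + 1 - n)` for `n - 1 ≤ p ≤ ∞`, with the usual limit values: it is `∞`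
at `p = n - 1` (where the quotient is `(n - 1) / 0 = ∞` in `ℝ≥0∞`, for `n ≥ 2`), and `1` at
`p = ∞`. -/
noncomputable def pBar (n : ℕ) (p : ℝ≥0∞) : ℝ≥0∞ :=
  if p = ⊤ then 1 else p / (p + 1 - n)

end DetEL

/-! Write `H = h(det Du)`. The two cases rest on different mechanisms, but both end with a function
whose weak gradient vanishes on a connected open set (`exists_ae_eq_const_ball`,
`exists_ae_eq_const_of_isPreconnected`).

Sobolev case. For a smooth map the rows of the cofactor matrix are divergence free (Piola,
`sum_partialDeriv_cof_gradMatrix`), so the derivative in the equation can be moved onto `H`. For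
Sobolev `u`, mollify: a subsequence of the mollified gradients is dominated by some `G` in `L^p`, so
their cofactors are dominated by a multiple of `G^(n-1)` in `L^{p/(n-1)}`, whose dual exponent is
exactly `pBar n p`. Dominated convergence then gives `cof(Du) ∇H = 0` almost everywhere. Domination
rather than norm convergence lets `p = ∞` be treated together with the other exponents. Where `det
Du ≠ 0` the cofactor matrix is invertible and `∇H = 0`; where `det Du = 0`, `H` takes the single
value `h 0`, and a weak gradient vanishes almost everywhere on a level set
(`IsWeakPartialDeriv.ae_eq_zero_of_eq`). Hence `H` is constant, and injectivity of `h` finishes.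

`C¹` case. Near a point with `det Du ≠ 0` the map `u` is a diffeomorphism onto its image. Testing
with `φ ∘ u` and using `cof(Du) ∇(φ ∘ u) = det Du · (∇φ) ∘ u`, a change of variables turns the
equation into the statement that `H ∘ u⁻¹` has zero weak gradient. So `H` is locally constant there,
and by the intermediate value theorem so is `det Du`, because `h` is constant on no interval. A
level set of `det Du` at a nonzero value is then open and closed in the domain, and connectedness
concludes. -/

namespace DetEL

open Filter Topology
open scoped Convolution

/-! ### Mollifiers: convergence and domination in `L^p` -/

section Mollification

/-- Minkowski's integral inequality against a probability measure, with a uniform bound. -/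
theorem eLpNorm_integral_le_of_ae_le {α β : Type*} [MeasurableSpace α] [MeasurableSpace β]
    {μ : Measure α} {ν : Measure β} [SFinite μ] [IsProbabilityMeasure ν] {F : α → β → ℝ}
    (hF : StronglyMeasurable (Function.uncurry F)) {p : ℝ≥0∞} (hp : 1 ≤ p) (hp' : p ≠ ⊤)
    {C : ℝ≥0∞} (hC : ∀ᵐ t ∂ν, eLpNorm (fun x => F x t) p μ ≤ C) :
    eLpNorm (fun x => ∫ t, F x t ∂ν) p μ ≤ C := by
  have hp0 : p ≠ 0 := (zero_lt_one.trans_le hp).ne'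
  have hpos : 0 < p.toReal := ENNReal.toReal_pos hp0 hp'
  rw [eLpNorm_eq_lintegral_rpow_enorm_toReal hp0 hp', one_div, ENNReal.rpow_inv_le_iff hpos]
  have hjensen : ∀ x, ‖∫ t, F x t ∂ν‖ₑ ^ p.toReal ≤ ∫⁻ t, ‖F x t‖ₑ ^ p.toReal ∂ν := by
    intro x
    have hm : AEStronglyMeasurable (F x) ν :=
      (hF.comp_measurable measurable_prodMk_left).aestronglyMeasurable
    -- Jensen's inequality in the form `‖·‖₁ ≤ ‖·‖_p` on a probability space.
    have h1 := eLpNorm_le_eLpNorm_of_exponent_le hp hm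
    rw [eLpNorm_one_eq_lintegral_enorm, eLpNorm_eq_lintegral_rpow_enorm_toReal hp0 hp', one_div,
      ENNReal.le_rpow_inv_iff hpos] at h1
    exact le_trans (by gcongr; exact enorm_integral_le_lintegral_enorm _) h1
  calc ∫⁻ x, ‖∫ t, F x t ∂ν‖ₑ ^ p.toReal ∂μ
      ≤ ∫⁻ x, ∫⁻ t, ‖F x t‖ₑ ^ p.toReal ∂ν ∂μ := lintegral_mono hjensen
    _ = ∫⁻ t, ∫⁻ x, ‖F x t‖ₑ ^ p.toReal ∂μ ∂ν :=
        lintegral_lintegral_swap (hF.measurable.enorm.pow_const _).aemeasurable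
    _ ≤ ∫⁻ _t, C ^ p.toReal ∂ν := by
        refine lintegral_mono_ae ?_
        filter_upwards [hC] with t ht
        rwa [eLpNorm_eq_lintegral_rpow_enorm_toReal hp0 hp', one_div,
          ENNReal.rpow_inv_le_iff hpos] at ht
    _ = C ^ p.toReal := by simp

variable {E : Type*} [NormedAddCommGroup E] [InnerProductSpace ℝ E] [FiniteDimensional ℝ E]
  [MeasurableSpace E] [BorelSpace E]

/-- Translations are continuous in `L^p` for `p < ∞`. -/
theorem tendsto_eLpNorm_translate_sub {f : E → ℝ} {p : ℝ≥0∞} (hp : 1 ≤ p) (hp' : p ≠ ⊤)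
    (hf : MemLp f p volume) :
    Tendsto (fun c => eLpNorm (fun x => f (c + x) - f x) p volume) (𝓝 (0 : E)) (𝓝 0) := by
  have : Fact (1 ≤ p) := ⟨hp⟩
  have : Fact (p ≠ ⊤) := ⟨hp'⟩
  -- The translation action on `L^p` is continuous for `p < ∞`; the claim is continuity of one orbit
  -- at zero.
  have hcont : Continuous fun c : E =>
      edist (DomAddAct.mk c +ᵥ hf.toLp f) (hf.toLp f) := by
    have : Continuous fun c : E => DomAddAct.mk c +ᵥ hf.toLp f :=
      (DomAddAct.continuous_mk).vadd continuous_const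
    exact this.edist continuous_const
  have h0 := hcont.tendsto 0
  have hz : (DomAddAct.mk (0 : E)) = 0 := rfl
  rw [hz, zero_vadd, edist_self] at h0
  refine h0.congr fun c => ?_
  rw [DomAddAct.mk_vadd_toLp, Lp.edist_toLp_toLp]
  rfl

theorem convolution_lsmul_eq_integral_normed (φ : ContDiffBump (0 : E)) (f : E → ℝ) (x : E) :
    (φ.normed volume ⋆[ContinuousLinearMap.lsmul ℝ ℝ, volume] f) x
      = ∫ t, φ.normed volume t * f (x - t) := rfl

theorem continuous_normed_convolution (φ : ContDiffBump (0 : E)) {f : E → ℝ}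
    (hf : LocallyIntegrable f volume) :
    Continuous (φ.normed volume ⋆[ContinuousLinearMap.lsmul ℝ ℝ, volume] f) :=
  (φ.hasCompactSupport_normed.continuous_convolution_left _ φ.continuous_normed hf)

/-- The probability measure with density a normed bump function. -/
theorem isProbabilityMeasure_withDensity_normed (φ : ContDiffBump (0 : E)) :
    IsProbabilityMeasure ((volume : Measure E).withDensity
      fun t => ENNReal.ofReal (φ.normed volume t)) := by
  constructor
  rw [withDensity_apply _ MeasurableSet.univ, Measure.restrict_univ,
    ← ofReal_integral_eq_lintegral_ofReal φ.integrable_normed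
      (Eventually.of_forall φ.nonneg_normed), φ.integral_normed, ENNReal.ofReal_one]

theorem integral_withDensity_normed (φ : ContDiffBump (0 : E)) (g : E → ℝ) :
    ∫ t, g t ∂((volume : Measure E).withDensity fun t => ENNReal.ofReal (φ.normed volume t))
      = ∫ t, φ.normed volume t * g t := by
  have hm : Measurable fun t => (φ.normed volume t).toNNReal :=
    φ.continuous_normed.measurable.real_toNNReal
  have := integral_withDensity_eq_integral_smul (μ := (volume : Measure E)) hm g
  simp only [ENNReal.ofReal] at *
  rw [this]
  refine integral_congr_ae (Eventually.of_forall fun t => ?_)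
  simp [NNReal.smul_def, Real.coe_toNNReal _ (φ.nonneg_normed t)]

/-- The difference is an average of `f(· - t) - f` against the probability measure with density the
bump, so Minkowski's inequality bounds it by the worst translation within the support. -/
theorem eLpNorm_normed_convolution_sub_le (φ : ContDiffBump (0 : E)) {f : E → ℝ} {p : ℝ≥0∞}
    (hp : 1 ≤ p) (hp' : p ≠ ⊤) (hf : MemLp f p volume) {C : ℝ≥0∞}
    (hC : ∀ c, ‖c‖ < φ.rOut → eLpNorm (fun x => f (c + x) - f x) p volume ≤ C) :
    eLpNorm ((φ.normed volume ⋆[ContinuousLinearMap.lsmul ℝ ℝ, volume] f) - f) p volume ≤ C := by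
  have := isProbabilityMeasure_withDensity_normed φ
  -- A strongly measurable representative makes `(x, t) ↦ f' (x - t)` jointly measurable.
  set f' := hf.1.mk f
  have hff' : f =ᵐ[volume] f' := hf.1.ae_eq_mk
  have hsm : StronglyMeasurable f' := hf.1.stronglyMeasurable_mk
  have hf' : MemLp f' p volume := hf.ae_eq hff'
  have hint : LocallyIntegrable f' volume := hf'.locallyIntegrable hp
  have hconv : (φ.normed volume ⋆[ContinuousLinearMap.lsmul ℝ ℝ, volume] f)
      = (φ.normed volume ⋆[ContinuousLinearMap.lsmul ℝ ℝ, volume] f') :=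
    convolution_congr _ EventuallyEq.rfl hff'
  have key : ∀ x, ((φ.normed volume ⋆[ContinuousLinearMap.lsmul ℝ ℝ, volume] f') - f') x
      = ∫ t, (f' (x - t) - f' x) ∂((volume : Measure E).withDensity
          fun t => ENNReal.ofReal (φ.normed volume t)) := by
    intro x
    rw [integral_withDensity_normed, Pi.sub_apply, convolution_lsmul_eq_integral_normed]
    simp_rw [mul_sub]
    rw [integral_sub, integral_mul_const, φ.integral_normed, one_mul]
    · exact (φ.hasCompactSupport_normed.convolutionExists_left
        (ContinuousLinearMap.lsmul ℝ ℝ) φ.continuous_normed hint x)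
    · exact φ.integrable_normed.mul_const _
  have e1 : eLpNorm ((φ.normed volume ⋆[ContinuousLinearMap.lsmul ℝ ℝ, volume] f) - f) p volume
      = eLpNorm (fun x => ∫ t, (f' (x - t) - f' x) ∂((volume : Measure E).withDensity
          fun t => ENNReal.ofReal (φ.normed volume t))) p volume := by
    rw [hconv]
    refine eLpNorm_congr_ae ?_
    filter_upwards [hff'] with x hx
    rw [← key x, Pi.sub_apply, Pi.sub_apply, hx]
  rw [e1]
  refine eLpNorm_integral_le_of_ae_le (F := fun x t => f' (x - t) - f' x) ?_ hp hp' ?_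
  · exact (hsm.comp_measurable (measurable_fst.sub measurable_snd)).sub
      (hsm.comp_measurable measurable_fst)
  · rw [ae_withDensity_iff (φ.continuous_normed.measurable.ennreal_ofReal)]
    refine Eventually.of_forall fun t ht => ?_
    have hpos : t ∈ Function.support (φ.normed volume) := by
      intro h0
      simp [h0] at ht
    rw [φ.support_normed_eq, mem_ball_zero_iff] at hpos
    refine le_trans (le_of_eq ?_) (hC (-t) (by simpa using hpos))
    refine eLpNorm_congr_ae ?_
    have h2 : ∀ᵐ x : E, f (-t + x) = f' (-t + x) :=
      (measurePreserving_add_left volume (-t)).quasiMeasurePreserving.ae hff'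
    filter_upwards [hff', h2] with x hx hx2
    rw [hx, hx2, sub_eq_add_neg x t, add_comm x]

/-- Mollifications converge in `L^p`, `1 ≤ p < ∞`. -/
theorem tendsto_eLpNorm_normed_convolution_sub {φ : ℕ → ContDiffBump (0 : E)}
    (hφ : Tendsto (fun k => (φ k).rOut) atTop (𝓝 0)) {f : E → ℝ} {p : ℝ≥0∞}
    (hp : 1 ≤ p) (hp' : p ≠ ⊤) (hf : MemLp f p volume) :
    Tendsto (fun k => eLpNorm
      (((φ k).normed volume ⋆[ContinuousLinearMap.lsmul ℝ ℝ, volume] f) - f) p volume)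
      atTop (𝓝 0) := by
  rw [ENNReal.tendsto_nhds_zero]
  intro ε hε
  have h1 := (ENNReal.tendsto_nhds_zero.1 (tendsto_eLpNorm_translate_sub hp hp' hf)) ε hε
  obtain ⟨δ, hδ, h2⟩ := Metric.eventually_nhds_iff.1 h1
  filter_upwards [hφ.eventually (gt_mem_nhds hδ)] with k hk
  refine eLpNorm_normed_convolution_sub_le (φ k) hp hp' hf fun c hc => h2 ?_
  rw [dist_zero_right]
  exact hc.trans hk

theorem abs_normed_convolution_le (φ : ContDiffBump (0 : E)) {f : E → ℝ} {C : ℝ}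
    (hf : ∀ᵐ x : E, ‖f x‖ ≤ C) (x : E) :
    ‖(φ.normed volume ⋆[ContinuousLinearMap.lsmul ℝ ℝ, volume] f) x‖ ≤ C := by
  have := isProbabilityMeasure_withDensity_normed φ
  rw [convolution_lsmul_eq_integral_normed, ← integral_withDensity_normed]
  have h1 : ∀ᵐ t : E, ‖f (x - t)‖ ≤ C :=
    (Measure.measurePreserving_sub_left volume x).quasiMeasurePreserving.ae hf
  simpa using norm_integral_le_of_norm_le_const ((withDensity_absolutelyContinuous
    (volume : Measure E) fun t => ENNReal.ofReal (φ.normed volume t)).ae_le h1)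

/-- A subsequence of the mollifications of finitely many `L^p` functions is dominated in `L^p`. -/
theorem exists_dominated_normed_convolution {φ : ℕ → ContDiffBump (0 : E)}
    (hφ : Tendsto (fun k => (φ k).rOut) atTop (𝓝 0)) {ι : Type*} [Finite ι] {g : ι → E → ℝ}
    {p : ℝ≥0∞} (hp : 1 ≤ p) (hg : ∀ i, MemLp (g i) p volume) :
    ∃ ns : ℕ → ℕ, StrictMono ns ∧ ∃ G : E → ℝ, MemLp G p volume ∧ ∀ i k, ∀ᵐ x : E,
      |((φ (ns k)).normed volume ⋆[ContinuousLinearMap.lsmul ℝ ℝ, volume] g i) x| ≤ G x := by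
  cases nonempty_fintype ι
  -- Mollifications need not converge in `L^∞`, but averaging does not increase the essential
  -- supremum, so constants dominate.
  by_cases hp' : p = ⊤
  · subst hp'
    refine ⟨id, strictMono_id, fun _ => ∑ i, (eLpNorm (g i) ⊤ volume).toReal,
      memLp_top_const _, fun i k => Eventually.of_forall fun x => ?_⟩
    refine le_trans (abs_normed_convolution_le (φ k) (C := (eLpNorm (g i) ⊤ volume).toReal) ?_ x) ?_
    · have hfin := (hg i).2.ne
      filter_upwards [ae_le_eLpNormEssSup (f := g i) (μ := volume)] with y hy
      rw [← eLpNorm_exponent_top, ← ENNReal.toReal_le_toReal enorm_ne_top hfin] at hy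
      simpa using hy
    · exact Finset.single_le_sum (f := fun i => (eLpNorm (g i) ⊤ volume).toReal)
        (fun _ _ => ENNReal.toReal_nonneg) (Finset.mem_univ i)
  have : Fact (1 ≤ p) := ⟨hp⟩
  let D : ℕ → ι → E → ℝ := fun k i =>
    ((φ k).normed volume ⋆[ContinuousLinearMap.lsmul ℝ ℝ, volume] g i) - g i
  have hlim : ∀ i, Tendsto (fun k => eLpNorm (D k i) p volume) atTop (𝓝 0) := fun i =>
    tendsto_eLpNorm_normed_convolution_sub hφ hp hp' (hg i)
  -- As in Riesz–Fischer: along a subsequence with errors at most `2^(-m)`, the absolute errors are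
  -- summable in `L^p`, and their sum dominates each of them.
  have hsmall : ∀ m : ℕ, ∀ᶠ k in atTop, ∀ i,
      eLpNorm (D k i) p volume ≤ ENNReal.ofReal ((1 / 2) ^ m) := by
    intro m
    rw [eventually_all]
    intro i
    exact ENNReal.tendsto_nhds_zero.1 (hlim i) _ (by positivity)
  obtain ⟨ns, hns, hns'⟩ := extraction_forall_of_eventually hsmall
  have hmem : ∀ k i, MemLp (D (ns k) i) p volume := fun k i =>
    ⟨((continuous_normed_convolution _ ((hg i).locallyIntegrable hp)).aestronglyMeasurable).sub
      (hg i).1, (hns' k i).trans_lt ENNReal.ofReal_lt_top⟩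
  let a : ι → ℕ → Lp ℝ p (volume : Measure E) := fun i k => |(hmem k i).toLp _|
  have hsum : ∀ i, Summable (a i) := by
    intro i
    refine Summable.of_norm_bounded (g := fun k => (1 / 2 : ℝ) ^ k)
      (summable_geometric_of_lt_one (by norm_num) (by norm_num)) fun k => ?_
    rw [norm_abs_eq_norm, Lp.norm_toLp]
    exact ENNReal.toReal_le_of_le_ofReal (by positivity) (hns' k i)
  -- Summing over the finite index gives one bound serving all the functions at once.
  refine ⟨ns, hns, fun x => ∑ i, (|g i x| + (∑' k, a i k : Lp ℝ p (volume : Measure E)) x), ?_, ?_⟩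
  · exact memLp_finsetSum _ fun i _ => (hg i).abs.add (Lp.memLp _)
  intro i k
  have hle : a i k ≤ ∑' k, a i k := (hsum i).le_tsum k fun j _ => abs_nonneg _
  have hnn : ∀ i', (0 : Lp ℝ p (volume : Measure E)) ≤ ∑' k, a i' k := fun i' =>
    tsum_nonneg fun j => abs_nonneg _
  have hnn' : ∀ᵐ x : E, ∀ i', 0 ≤ (∑' k, a i' k : Lp ℝ p (volume : Measure E)) x := by
    rw [ae_all_iff]
    intro i'
    filter_upwards [(Lp.coeFn_nonneg _).2 (hnn i')] with x hx
    exact hx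
  filter_upwards [(Lp.coeFn_le _ _).2 hle, Lp.coeFn_abs ((hmem k i).toLp _),
    (hmem k i).coeFn_toLp, hnn'] with x h1 h2 h3 h4
  have h5 : |D (ns k) i x| ≤ (∑' k, a i k : Lp ℝ p (volume : Measure E)) x := by
    rw [← h3, ← h2]; exact h1
  have h6 : ((φ (ns k)).normed volume ⋆[ContinuousLinearMap.lsmul ℝ ℝ, volume] g i) x
      = g i x + D (ns k) i x := by simp [D]
  rw [h6]
  refine le_trans ((abs_add_le _ _).trans (add_le_add_right h5 |g i x|)) ?_
  exact Finset.single_le_sum (f := fun i => |g i x| + (∑' k, a i k : Lp ℝ p (volume : Measure E)) x)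
    (fun i' _ => add_nonneg (abs_nonneg _) (h4 i')) (Finset.mem_univ i)

end Mollification

variable {n : ℕ}

/-! ### Weak derivatives and smooth approximation -/

section WeakDerivatives

theorem MemLpLoc.locallyIntegrableOn {Ω : Set (EuclideanSpace ℝ (Fin n))} (hΩ : IsOpen Ω)
    {f : EuclideanSpace ℝ (Fin n) → ℝ} (hf : MemLpLoc Ω 1 f) :
    LocallyIntegrableOn f Ω volume :=
  (locallyIntegrableOn_iff hΩ.isLocallyClosed).2 fun K hKΩ hK =>
    memLp_one_iff_integrable.1 (hf K hK hKΩ)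

theorem MemLpLoc.memLp_indicator {Ω K : Set (EuclideanSpace ℝ (Fin n))} {p : ℝ≥0∞}
    {f : EuclideanSpace ℝ (Fin n) → ℝ} (hf : MemLpLoc Ω p f) (hK : IsCompact K) (hKΩ : K ⊆ Ω) :
    MemLp (K.indicator f) p volume :=
  (memLp_indicator_iff_restrict hK.measurableSet).2 (hf K hK hKΩ)

theorem setIntegral_eq_setIntegral_tsupport {Ω : Set (EuclideanSpace ℝ (Fin n))} (hΩ : IsOpen Ω)
    {φ X : EuclideanSpace ℝ (Fin n) → ℝ} (hφ : tsupport φ ⊆ Ω)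
    (hX : ∀ x, x ∉ tsupport φ → X x = 0) : ∫ x in Ω, X x = ∫ x in tsupport φ, X x :=
  setIntegral_eq_of_subset_of_forall_sdiff_eq_zero hΩ.measurableSet hφ fun x hx => hX x hx.2

theorem partialDeriv_eq_zero_of_notMem_tsupport {φ : EuclideanSpace ℝ (Fin n) → ℝ}
    {x : EuclideanSpace ℝ (Fin n)} (hx : x ∉ tsupport φ) (j : Fin n) : partialDeriv j φ x = 0 := by
  have : fderiv ℝ φ x = 0 := image_eq_zero_of_notMem_tsupport fun h => hx (tsupport_fderiv_subset ℝ h)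
  simp [partialDeriv, this]

theorem continuous_partialDeriv {φ : EuclideanSpace ℝ (Fin n) → ℝ} (hφ : ContDiff ℝ 1 φ)
    (j : Fin n) : Continuous (partialDeriv j φ) :=
  (hφ.continuous_fderiv (by simp)).clm_apply continuous_const

theorem contDiff_partialDeriv {φ : EuclideanSpace ℝ (Fin n) → ℝ} (hφ : ContDiff ℝ ∞ φ)
    (j : Fin n) : ContDiff ℝ ∞ (partialDeriv j φ) :=
  (hφ.fderiv_right (m := ∞) (by simp)).clm_apply contDiff_const

/-- The weak partial derivative is unique up to null sets. -/
theorem IsWeakPartialDeriv.ae_eq {Ω : Set (EuclideanSpace ℝ (Fin n))} (hΩ : IsOpen Ω)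
    {j : Fin n} {f g g' : EuclideanSpace ℝ (Fin n) → ℝ} (h : IsWeakPartialDeriv Ω j f g)
    (h' : IsWeakPartialDeriv Ω j f g') : ∀ᵐ x ∂(volume.restrict Ω), g x = g' x := by
  have hl := h.memLpLoc_deriv.locallyIntegrableOn hΩ
  have hl' := h'.memLpLoc_deriv.locallyIntegrableOn hΩ
  rw [ae_restrict_iff' hΩ.measurableSet]
  have := hΩ.ae_eq_zero_of_integral_contDiff_smul_eq_zero (hl.sub hl') (by
    intro φ hφ hc hs
    have e := (h.integral_eq φ hφ hc hs).symm.trans (h'.integral_eq φ hφ hc hs)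
    have hz : ∀ x, x ∉ Ω → φ x • (g - g') x = 0 := fun x hx => by
      simp [image_eq_zero_of_notMem_tsupport fun h => hx (hs h)]
    rw [← setIntegral_eq_integral_of_forall_compl_eq_zero hz]
    have i1 : IntegrableOn (fun x => g x * φ x) (tsupport φ) := by
      exact IntegrableOn.mul_continuousOn (memLp_one_iff_integrable.1 (h.memLpLoc_deriv _ hc hs))
        hφ.continuous.continuousOn hc
    have i2 : IntegrableOn (fun x => g' x * φ x) (tsupport φ) := by
      exact IntegrableOn.mul_continuousOn (memLp_one_iff_integrable.1 (h'.memLpLoc_deriv _ hc hs))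
        hφ.continuous.continuousOn hc
    have z1 : ∀ g : EuclideanSpace ℝ (Fin n) → ℝ, ∀ x, x ∉ tsupport φ → g x * φ x = 0 :=
      fun g x hx => by simp [image_eq_zero_of_notMem_tsupport hx]
    rw [neg_inj, setIntegral_eq_setIntegral_tsupport hΩ hs (z1 g),
      setIntegral_eq_setIntegral_tsupport hΩ hs (z1 g')] at e
    rw [setIntegral_eq_setIntegral_tsupport hΩ hs
      fun x hx => by simp [image_eq_zero_of_notMem_tsupport hx]]
    rw [← sub_eq_zero, ← integral_sub i1 i2] at e
    rw [← e]
    refine integral_congr_ae (Eventually.of_forall fun x => ?_)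
    simp; ring)
  filter_upwards [this] with x hx hxΩ
  exact sub_eq_zero.1 (hx hxΩ)

theorem IsWeakPartialDeriv.congr_deriv {Ω : Set (EuclideanSpace ℝ (Fin n))}
    {j : Fin n} {f g g' : EuclideanSpace ℝ (Fin n) → ℝ} (h : IsWeakPartialDeriv Ω j f g)
    (hg : ∀ᵐ x ∂(volume.restrict Ω), g x = g' x) : IsWeakPartialDeriv Ω j f g' where
  memLpLoc_fun := h.memLpLoc_fun
  memLpLoc_deriv K hK hKΩ :=
    (h.memLpLoc_deriv K hK hKΩ).ae_eq (ae_restrict_of_ae_restrict_of_subset hKΩ hg)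
  integral_eq φ hφ hc hs := by
    rw [h.integral_eq φ hφ hc hs, neg_inj]
    refine integral_congr_ae ?_
    filter_upwards [hg] with x hx
    rw [hx]

theorem memLpLoc_of_continuousOn {Ω : Set (EuclideanSpace ℝ (Fin n))} {p : ℝ≥0∞}
    {f : EuclideanSpace ℝ (Fin n) → ℝ} (hf : ContinuousOn f Ω) : MemLpLoc Ω p f := by
  intro K hK hKΩ
  have hc := hf.mono hKΩ
  have : IsFiniteMeasure ((volume : Measure (EuclideanSpace ℝ (Fin n))).restrict K) :=
    ⟨by simpa using hK.measure_lt_top⟩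
  obtain ⟨C, hC⟩ := hK.exists_bound_of_continuousOn hc
  exact MemLp.of_bound (hc.aestronglyMeasurable hK.measurableSet) C
    (ae_restrict_of_forall_mem hK.measurableSet hC)

/-- The classical partial derivatives of a `C¹` function are its weak ones. -/
theorem isWeakPartialDeriv_of_contDiffOn {Ω : Set (EuclideanSpace ℝ (Fin n))} (hΩ : IsOpen Ω)
    {f : EuclideanSpace ℝ (Fin n) → ℝ} (hf : ContDiffOn ℝ 1 f Ω) (j : Fin n) :
    IsWeakPartialDeriv Ω j f (partialDeriv j f) := by
  have hd : ContinuousOn (partialDeriv j f) Ω :=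
    (hf.continuousOn_fderiv_of_isOpen hΩ le_rfl).clm_apply continuousOn_const
  refine ⟨memLpLoc_of_continuousOn hf.continuousOn, memLpLoc_of_continuousOn hd, ?_⟩
  intro φ hφ hc hs
  have hφ1 : ContDiff ℝ 1 φ := hφ.of_le (by simp)
  have hint : ∀ a b : EuclideanSpace ℝ (Fin n) → ℝ, ContinuousOn a Ω → Continuous b →
      (∀ x, x ∉ tsupport φ → b x = 0) → Integrable (fun x => a x * b x) := by
    intro a b ha hb hz
    have h1 : IntegrableOn (fun x => a x * b x) (tsupport φ) :=
      ((ha.mono hs).mul hb.continuousOn).integrableOn_compact hc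
    exact h1.integrable_of_forall_notMem_eq_zero fun x hx => by simp [hz x hx]
  have z0 : ∀ x, x ∉ tsupport φ → φ x = 0 := fun x hx => image_eq_zero_of_notMem_tsupport hx
  have z1 : ∀ x, x ∉ tsupport φ → partialDeriv j φ x = 0 :=
    fun x hx => partialDeriv_eq_zero_of_notMem_tsupport hx j
  rw [setIntegral_eq_integral_of_forall_compl_eq_zero
      (fun x hx => by simp [z1 x fun h => hx (hs h)]),
    setIntegral_eq_integral_of_forall_compl_eq_zero
      (fun x hx => by simp [z0 x fun h => hx (hs h)])]
  refine integral_mul_fderiv_eq_neg_fderiv_mul_of_integrable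
    (hint _ _ hd hφ.continuous z0) (hint _ _ hf.continuousOn (continuous_partialDeriv hφ1 j) z1)
    (hint _ _ hf.continuousOn hφ.continuous z0) (fun x hx => ?_) (fun x hx => ?_)
  · exact (hf.contDiffAt (hΩ.mem_nhds (hs hx))).differentiableAt (by simp)
  · exact hφ1.differentiable (by simp) x

/-- Mollification commutes with weak differentiation. -/
theorem IsWeakPartialDeriv.partialDeriv_convolution {Ω K : Set (EuclideanSpace ℝ (Fin n))}
    {j : Fin n} {f g : EuclideanSpace ℝ (Fin n) → ℝ} (h : IsWeakPartialDeriv Ω j f g)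
    (hK : IsCompact K) (hKΩ : K ⊆ Ω)
    (φ : ContDiffBump (0 : EuclideanSpace ℝ (Fin n)))
    {x : EuclideanSpace ℝ (Fin n)} (hx : Metric.closedBall x φ.rOut ⊆ K) :
    partialDeriv j
      (φ.normed volume ⋆[ContinuousLinearMap.lsmul ℝ ℝ, volume] (K.indicator f)) x
      = (φ.normed volume ⋆[ContinuousLinearMap.lsmul ℝ ℝ, volume] (K.indicator g)) x := by
  have hf : LocallyIntegrable (K.indicator f) volume :=
    (h.memLpLoc_fun.memLp_indicator hK hKΩ).locallyIntegrable le_rfl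
  have hφ : ContDiff ℝ ∞ (φ.normed volume) := φ.contDiff_normed
  have hφ1 : ContDiff ℝ 1 (φ.normed volume) := φ.contDiff_normed
  have hder := φ.hasCompactSupport_normed.hasFDerivAt_convolution_left
    (ContinuousLinearMap.lsmul ℝ ℝ) hφ1 hf x
  -- The reflected, translated mollifier is the test function; the sign from the reflection cancels
  -- the one from integration by parts. Its support lies in `K`, so the cut-off by the indicator is
  -- not seen.
  set ψ : EuclideanSpace ℝ (Fin n) → ℝ := fun y => φ.normed volume (x - y) with hψ
  have hψs : ContDiff ℝ ∞ ψ := hφ.comp (contDiff_const.sub contDiff_id)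
  have hsupp : tsupport ψ ⊆ Metric.closedBall x φ.rOut := by
    refine closure_minimal (fun y hy => ?_) Metric.isClosed_closedBall
    have hy' : x - y ∈ Function.support (φ.normed volume) := hy
    rw [φ.support_normed_eq, mem_ball_zero_iff] at hy'
    rw [Metric.mem_closedBall, dist_comm, dist_eq_norm]
    exact hy'.le
  have hψc : HasCompactSupport ψ :=
    (isCompact_closedBall x φ.rOut).of_isClosed_subset (isClosed_tsupport _) hsupp
  have hψΩ : tsupport ψ ⊆ Ω := hsupp.trans (hx.trans hKΩ)
  have hψd : ∀ y, partialDeriv j ψ y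
      = - fderiv ℝ (φ.normed volume) (x - y) (EuclideanSpace.single j 1) := by
    intro y
    have h1 : HasFDerivAt ψ ((fderiv ℝ (φ.normed volume) (x - y)).comp
        (-ContinuousLinearMap.id ℝ _)) y :=
      ((hφ1.differentiable (by simp) (x - y)).hasFDerivAt).comp y ((hasFDerivAt_id y).const_sub x)
    rw [partialDeriv, h1.fderiv]
    simp
  have hmain := h.integral_eq ψ hψs hψc hψΩ
  have hzero : ∀ y, y ∉ K → ψ y = 0 := fun y hy =>
    image_eq_zero_of_notMem_tsupport fun h' => hy (hx (hsupp h'))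
  have hzero' : ∀ y, y ∉ K → partialDeriv j ψ y = 0 := fun y hy =>
    partialDeriv_eq_zero_of_notMem_tsupport (fun h' => hy (hx (hsupp h'))) j
  have hind : ∀ a b : EuclideanSpace ℝ (Fin n) → ℝ, (∀ y, y ∉ K → b y = 0) →
      ∫ y in Ω, a y * b y = ∫ y, K.indicator a y * b y := by
    intro a b hb
    rw [setIntegral_eq_integral_of_forall_compl_eq_zero
      (fun y hy => by simp [hb y fun h' => hy (hKΩ h')])]
    refine integral_congr_ae (Eventually.of_forall fun y => ?_)
    by_cases hy : y ∈ K
    · simp [hy]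
    · simp [hy, hb y hy]
  rw [hind _ _ hzero', hind _ _ hzero] at hmain
  rw [partialDeriv, hder.fderiv, convolution_eq_swap,
    ContinuousLinearMap.integral_apply]
  · rw [convolution_eq_swap]
    simp only [ContinuousLinearMap.precompL_apply, ContinuousLinearMap.lsmul_apply, smul_eq_mul]
    have e2 : ∫ t, φ.normed volume (x - t) * K.indicator g t = ∫ y, K.indicator g y * ψ y := by
      simp [hψ, mul_comm]
    rw [e2, ← neg_inj, ← hmain, ← integral_neg]
    refine integral_congr_ae (Eventually.of_forall fun y => ?_)
    simp only [hψd]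
    ring
  · have hex := (φ.hasCompactSupport_normed.fderiv ℝ).convolutionExists_left
      ((ContinuousLinearMap.lsmul ℝ ℝ).precompL (EuclideanSpace ℝ (Fin n)))
      (hφ1.continuous_fderiv (by simp)) hf x
    exact hex.integrable_swap

/-- Finitely many functions with weak derivatives in `L^p_loc` are approximated on compact sets,
almost everywhere and with derivatives dominated in `L^p`, by smooth functions. -/
theorem exists_smooth_approx {ι : Type*} [Finite ι] {Ω K : Set (EuclideanSpace ℝ (Fin n))}
    (hΩ : IsOpen Ω) (hK : IsCompact K) (hKΩ : K ⊆ Ω) {p : ℝ≥0∞} (hp : 1 ≤ p)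
    {f : ι → EuclideanSpace ℝ (Fin n) → ℝ} {g : ι → Fin n → EuclideanSpace ℝ (Fin n) → ℝ}
    (hf : ∀ i, MemLpLoc Ω 1 (f i)) (hw : ∀ i j, IsWeakPartialDeriv Ω j (f i) (g i j))
    (hg : ∀ i j, MemLpLoc Ω p (g i j)) :
    ∃ w : ℕ → ι → EuclideanSpace ℝ (Fin n) → ℝ, (∀ k i, ContDiff ℝ ∞ (w k i)) ∧
      (∀ i, ∀ᵐ x ∂(volume.restrict K), Tendsto (fun k => w k i x) atTop (𝓝 (f i x))) ∧
      (∀ i j, ∀ᵐ x ∂(volume.restrict K),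
        Tendsto (fun k => partialDeriv j (w k i) x) atTop (𝓝 (g i j x))) ∧
      ∃ G : EuclideanSpace ℝ (Fin n) → ℝ, MemLp G p (volume.restrict K) ∧
        ∀ k i j, ∀ᵐ x ∂(volume.restrict K), |partialDeriv j (w k i) x| ≤ G x := by
  obtain ⟨δ, hδ, hδΩ⟩ := hK.exists_cthickening_subset_open hΩ hKΩ
  -- The thickening leaves room for every mollifying ball centred in `K`.
  set K' := Metric.cthickening δ K with hK'def
  have hK' : IsCompact K' := hK.cthickening
  have hKK' : K ⊆ K' := Metric.self_subset_cthickening K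
  let φ : ℕ → ContDiffBump (0 : EuclideanSpace ℝ (Fin n)) := fun k =>
    { rIn := δ / (k + 1) / 2
      rOut := δ / (k + 1)
      rIn_pos := by positivity
      rIn_lt_rOut := half_lt_self (by positivity) }
  have hφ : Tendsto (fun k => (φ k).rOut) atTop (𝓝 0) :=
    tendsto_const_div_atTop_nhds_zero_nat δ |>.comp (tendsto_add_atTop_nat 1) |>.congr
      fun k => by simp [φ]
  -- A bounded ratio of radii is what Lebesgue differentiation needs for convergence almost
  -- everywhere.
  have hφ2 : ∀ k, (φ k).rOut ≤ 2 * (φ k).rIn := fun k => by simp only [φ]; linarith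
  have hφδ : ∀ k, (φ k).rOut ≤ δ := fun k => by
    simp only [φ]
    exact div_le_self hδ.le (by linarith [(Nat.cast_nonneg k : (0 : ℝ) ≤ k)])
  have hball : ∀ k, ∀ x ∈ K, Metric.closedBall x (φ k).rOut ⊆ K' := fun k x hx =>
    (Metric.closedBall_subset_closedBall (hφδ k)).trans (Metric.closedBall_subset_cthickening hx δ)
  obtain ⟨ns, hns, G, hG, hdom⟩ := exists_dominated_normed_convolution hφ
    (g := fun ij : ι × Fin n => K'.indicator (g ij.1 ij.2)) hp
    fun ij => (hg ij.1 ij.2).memLp_indicator hK' hδΩ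
  have hfi : ∀ i, LocallyIntegrable (K'.indicator (f i)) volume := fun i =>
    ((hf i).memLp_indicator hK' hδΩ).locallyIntegrable le_rfl
  have hgi : ∀ i j, LocallyIntegrable (K'.indicator (g i j)) volume := fun i j =>
    ((hg i j).memLp_indicator hK' hδΩ).locallyIntegrable hp
  have hae : ∀ a : EuclideanSpace ℝ (Fin n) → ℝ, LocallyIntegrable (K'.indicator a) volume →
      ∀ᵐ x ∂(volume.restrict K), Tendsto (fun k => ((φ (ns k)).normed volume
        ⋆[ContinuousLinearMap.lsmul ℝ ℝ, volume] K'.indicator a) x) atTop (𝓝 (a x)) := by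
    intro a ha
    have := ContDiffBump.ae_convolution_tendsto_right_of_locallyIntegrable hφ
      (Eventually.of_forall hφ2) ha
    rw [ae_restrict_iff' hK.measurableSet]
    filter_upwards [this] with x hx hxK
    rw [Set.indicator_of_mem (hKK' hxK)] at hx
    exact hx.comp hns.tendsto_atTop
  have hpd : ∀ k i j, ∀ x ∈ K, partialDeriv j ((φ k).normed volume
      ⋆[ContinuousLinearMap.lsmul ℝ ℝ, volume] K'.indicator (f i)) x = ((φ k).normed volume
      ⋆[ContinuousLinearMap.lsmul ℝ ℝ, volume] K'.indicator (g i j)) x := fun k i j x hx =>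
    (hw i j).partialDeriv_convolution hK' hδΩ (φ k) (hball k x hx)
  refine ⟨fun k i => (φ (ns k)).normed volume
      ⋆[ContinuousLinearMap.lsmul ℝ ℝ, volume] K'.indicator (f i), fun k i => ?_, fun i => ?_,
      fun i j => ?_, G, hG.restrict K, fun k i j => ?_⟩
  · exact (φ (ns k)).hasCompactSupport_normed.contDiff_convolution_left _
      (φ (ns k)).contDiff_normed (hfi i)
  · exact hae _ (hfi i)
  · filter_upwards [hae _ (hgi i j), ae_restrict_mem hK.measurableSet] with x hx hxK
    exact hx.congr fun k => (hpd _ i j x hxK).symm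
  · filter_upwards [ae_restrict_of_ae (hdom (i, j) k), ae_restrict_mem hK.measurableSet]
      with x hx hxK
    rw [hpd _ i j x hxK]
    exact hx

end WeakDerivatives

/-! ### Level sets and functions with zero weak gradient -/

section Consequences

/-- The chain rule for weak derivatives, tested against a smooth function. -/
theorem IsWeakPartialDeriv.integral_comp_eq {Ω : Set (EuclideanSpace ℝ (Fin n))} (hΩ : IsOpen Ω)
    {j : Fin n} {f : EuclideanSpace ℝ (Fin n) → ℝ} {g : Fin n → EuclideanSpace ℝ (Fin n) → ℝ}
    (h : ∀ j, IsWeakPartialDeriv Ω j f (g j)) {F F' : ℝ → ℝ} (hF : ∀ t, HasDerivAt F (F' t) t)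
    (hF'c : Continuous F') {B B' : ℝ} (hB : ∀ t, |F t| ≤ B) (hB' : ∀ t, |F' t| ≤ B')
    {φ : EuclideanSpace ℝ (Fin n) → ℝ} (hφ : ContDiff ℝ ∞ φ) (hc : HasCompactSupport φ)
    (hs : tsupport φ ⊆ Ω) :
    ∫ x in Ω, F (f x) * partialDeriv j φ x = - ∫ x in Ω, F' (f x) * g j x * φ x := by
  have hφ1 : ContDiff ℝ 1 φ := hφ.of_le (by simp)
  obtain ⟨w, hw, hwf, hwg, G, hG, hdom⟩ := exists_smooth_approx (ι := Unit) hΩ hc hs le_rfl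
    (fun _ => (h j).memLpLoc_fun) (fun _ j => h j) (fun _ j => (h j).memLpLoc_deriv)
  have hFc : Continuous F := continuous_iff_continuousAt.2 fun t => (hF t).continuousAt
  have hF1 : ContDiff ℝ 1 F := contDiff_one_iff_deriv.2
    ⟨fun t => (hF t).differentiableAt, by rwa [show deriv F = F' from funext fun t => (hF t).deriv]⟩
  have z0 : ∀ x, x ∉ tsupport φ → φ x = 0 := fun x hx => image_eq_zero_of_notMem_tsupport hx
  have z1 : ∀ x, x ∉ tsupport φ → partialDeriv j φ x = 0 :=
    fun x hx => partialDeriv_eq_zero_of_notMem_tsupport hx j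
  rw [setIntegral_eq_setIntegral_tsupport hΩ hs fun x hx => by simp [z1 x hx],
    setIntegral_eq_setIntegral_tsupport hΩ hs fun x hx => by simp [z0 x hx]]
  have hfin : IsFiniteMeasure
      ((volume : Measure (EuclideanSpace ℝ (Fin n))).restrict (tsupport φ)) :=
    ⟨by simpa using hc.isCompact.measure_lt_top⟩
  obtain ⟨C, hC⟩ := hc.exists_bound_of_continuous hφ.continuous
  obtain ⟨C', hC'⟩ := (show HasCompactSupport (partialDeriv j φ) from
    HasCompactSupport.intro hc z1).exists_bound_of_continuous (continuous_partialDeriv hφ1 j)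
  -- The classical chain rule for the approximants; both sides then pass to the limit by dominated
  -- convergence, using that `F` and `F'` are bounded.
  have hsm : ∀ k, ∫ x in tsupport φ, F (w k () x) * partialDeriv j φ x
      = - ∫ x in tsupport φ, F' (w k () x) * partialDeriv j (w k ()) x * φ x := by
    intro k
    have hcd : ContDiff ℝ 1 (fun x => F (w k () x)) := hF1.comp ((hw k ()).of_le (by simp))
    have hwk := isWeakPartialDeriv_of_contDiffOn hΩ hcd.contDiffOn j
    have hpd : ∀ x, partialDeriv j (fun x => F (w k () x)) x
        = F' (w k () x) * partialDeriv j (w k ()) x := by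
      intro x
      have h1 := (hF (w k () x)).comp_hasFDerivAt x
        (((hw k ()).differentiable (by simp) x).hasFDerivAt)
      have h2 : HasFDerivAt (fun x => F (w k () x)) _ x := h1
      rw [partialDeriv, h2.fderiv]
      simp [partialDeriv]
    have := hwk.integral_eq φ hφ hc hs
    simp_rw [hpd] at this
    rwa [setIntegral_eq_setIntegral_tsupport hΩ hs fun x hx => by simp [z1 x hx],
      setIntegral_eq_setIntegral_tsupport hΩ hs fun x hx => by simp [z0 x hx]] at this
  have hwc : ∀ k, Continuous (w k ()) := fun k => (hw k ()).continuous
  have hw1 : ∀ k, Continuous (partialDeriv j (w k ())) := fun k =>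
    continuous_partialDeriv ((hw k ()).of_le (by simp)) j
  have L1 : Tendsto (fun k => ∫ x in tsupport φ, F (w k () x) * partialDeriv j φ x) atTop
      (𝓝 (∫ x in tsupport φ, F (f x) * partialDeriv j φ x)) := by
    refine tendsto_integral_of_dominated_convergence (fun _ => B * C') (fun k => ?_)
      (integrable_const _) (fun k => Eventually.of_forall fun x => ?_) ?_
    · exact ((hFc.comp (hwc k)).mul (continuous_partialDeriv hφ1 j)).aestronglyMeasurable
    · rw [norm_mul]
      exact mul_le_mul (hB _) (hC' x) (norm_nonneg _) ((abs_nonneg _).trans (hB 0))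
    · filter_upwards [hwf ()] with x hx
      exact ((hFc.tendsto _).comp hx).mul_const _
  have L2 : Tendsto (fun k => ∫ x in tsupport φ,
      F' (w k () x) * partialDeriv j (w k ()) x * φ x) atTop
      (𝓝 (∫ x in tsupport φ, F' (f x) * g j x * φ x)) := by
    refine tendsto_integral_of_dominated_convergence (fun x => B' * G x * C) (fun k => ?_)
      (((memLp_one_iff_integrable.1 hG).const_mul _).mul_const _) (fun k => ?_) ?_
    · exact (((hF'c.comp (hwc k)).mul (hw1 k)).mul hφ.continuous).aestronglyMeasurable
    · filter_upwards [hdom k () j] with x hx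
      rw [norm_mul, norm_mul]
      have hG0 : 0 ≤ G x := (abs_nonneg _).trans hx
      have hB0 : 0 ≤ B' := (abs_nonneg _).trans (hB' 0)
      exact mul_le_mul (mul_le_mul (hB' _) hx (norm_nonneg _) hB0) (hC x) (norm_nonneg _)
        (mul_nonneg hB0 hG0)
    · filter_upwards [hwf (), hwg () j] with x hx hx'
      exact (((hF'c.tendsto _).comp hx).mul hx').mul_const _
  refine tendsto_nhds_unique L1 ?_
  simp_rw [hsm]
  exact L2.neg

/-- The weak gradient of a Sobolev function vanishes almost everywhere on its level sets. -/
theorem IsWeakPartialDeriv.ae_eq_zero_of_eq {Ω : Set (EuclideanSpace ℝ (Fin n))} (hΩ : IsOpen Ω)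
    {f : EuclideanSpace ℝ (Fin n) → ℝ} {g : Fin n → EuclideanSpace ℝ (Fin n) → ℝ}
    (h : ∀ j, IsWeakPartialDeriv Ω j f (g j)) (c : ℝ) (j : Fin n) :
    ∀ᵐ x ∂(volume.restrict Ω), f x = c → g j x = 0 := by
  set S : EuclideanSpace ℝ (Fin n) → ℝ := fun x => if f x = c then 1 else 0 with hS
  have hSle : ∀ x, ‖S x‖ ≤ 1 := fun x => by simp only [hS]; split_ifs <;> simp
  -- These functions tend uniformly to zero while their derivatives, bounded by one, tend to the
  -- indicator of `{c}`. In the limit the chain rule says that `S * g j` annihilates every test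
  -- function.
  let F : ℕ → ℝ → ℝ := fun m t => Real.arctan ((m + 1) * (t - c)) / (m + 1)
  let F' : ℕ → ℝ → ℝ := fun m t => 1 / (1 + ((m + 1) * (t - c)) ^ 2)
  have hF : ∀ m t, HasDerivAt (F m) (F' m t) t := by
    intro m t
    have hm : (m + 1 : ℝ) ≠ 0 := by positivity
    have h1 : HasDerivAt (fun t : ℝ => (m + 1 : ℝ) * (t - c)) ((m + 1 : ℝ) * 1) t :=
      ((hasDerivAt_id t).sub_const c).const_mul _
    have h2 := (h1.arctan).div_const (m + 1 : ℝ)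
    refine h2.congr_deriv ?_
    simp only [F']
    field_simp
  have hF'c : ∀ m, Continuous (F' m) := fun m =>
    continuous_const.div (by fun_prop) fun t => by positivity
  have hF'1 : ∀ m t, |F' m t| ≤ 1 := by
    intro m t
    simp only [F']
    rw [abs_of_nonneg (by positivity)]
    exact div_le_one_of_le₀ (by nlinarith [sq_nonneg ((m + 1 : ℝ) * (t - c))]) (by positivity)
  have hFb : ∀ m t, |F m t| ≤ 2 / (m + 1) := by
    intro m t
    simp only [F]
    rw [abs_div, abs_of_pos (by positivity : (0 : ℝ) < m + 1)]
    gcongr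
    rw [abs_le]
    constructor <;> linarith [Real.neg_pi_div_two_lt_arctan ((m + 1 : ℝ) * (t - c)),
      Real.arctan_lt_pi_div_two ((m + 1 : ℝ) * (t - c)), Real.pi_lt_four]
  have hcast : Tendsto (fun m : ℕ => (m + 1 : ℝ)) atTop atTop :=
    tendsto_atTop_add_const_right _ _ tendsto_natCast_atTop_atTop
  have hlim0 : Tendsto (fun m : ℕ => 2 / (m + 1 : ℝ)) atTop (𝓝 0) := hcast.const_div_atTop 2
  have hlimF : ∀ t, Tendsto (fun m => F m t) atTop (𝓝 0) := fun t =>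
    squeeze_zero_norm (fun m => hFb m t) hlim0
  have hlimF' : ∀ x, Tendsto (fun m => F' m (f x)) atTop (𝓝 (S x)) := by
    intro x
    by_cases hx : f x = c
    · simp [F', hS, hx]
    · simp only [hS, hx, if_false, F']
      have h1 : Tendsto (fun m : ℕ => ((m + 1 : ℝ)) ^ 2 * (f x - c) ^ 2) atTop atTop :=
        ((tendsto_pow_atTop two_ne_zero).comp hcast).atTop_mul_const
          (by have := sub_ne_zero.2 hx; positivity)
      have h2 := (tendsto_atTop_add_const_left _ (1 : ℝ) h1).const_div_atTop 1
      exact h2.congr fun m => by rw [mul_pow]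
  have hgS : ∀ K, IsCompact K → K ⊆ Ω → Integrable (fun x => S x * g j x) (volume.restrict K) := by
    intro K hK hKΩ
    have hfm : AEStronglyMeasurable f (volume.restrict K) :=
      ((h j).memLpLoc_fun K hK hKΩ).1
    have hgi : Integrable (g j) (volume.restrict K) :=
      memLp_one_iff_integrable.1 ((h j).memLpLoc_deriv K hK hKΩ)
    have hSm : AEStronglyMeasurable S (volume.restrict K) :=
      aestronglyMeasurable_of_tendsto_ae atTop
        (fun m => (hF'c m).comp_aestronglyMeasurable hfm) (Eventually.of_forall hlimF')
    exact hgi.bdd_mul hSm (Eventually.of_forall hSle)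
  have key : ∀ φ : EuclideanSpace ℝ (Fin n) → ℝ, ContDiff ℝ ∞ φ → HasCompactSupport φ →
      tsupport φ ⊆ Ω → ∫ x in tsupport φ, S x * g j x * φ x = 0 := by
    intro φ hφ hc hs
    have hφ1 : ContDiff ℝ 1 φ := hφ.of_le (by simp)
    have z0 : ∀ x, x ∉ tsupport φ → φ x = 0 := fun x hx => image_eq_zero_of_notMem_tsupport hx
    have z1 : ∀ x, x ∉ tsupport φ → partialDeriv j φ x = 0 :=
      fun x hx => partialDeriv_eq_zero_of_notMem_tsupport hx j
    have hfin : IsFiniteMeasure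
        ((volume : Measure (EuclideanSpace ℝ (Fin n))).restrict (tsupport φ)) :=
      ⟨by simpa using hc.isCompact.measure_lt_top⟩
    obtain ⟨C, hC⟩ := hc.exists_bound_of_continuous hφ.continuous
    obtain ⟨C', hC'⟩ := (show HasCompactSupport (partialDeriv j φ) from
      HasCompactSupport.intro hc z1).exists_bound_of_continuous (continuous_partialDeriv hφ1 j)
    have hfm : AEStronglyMeasurable f (volume.restrict (tsupport φ)) :=
      ((h j).memLpLoc_fun _ hc hs).1
    have hgi : Integrable (g j) (volume.restrict (tsupport φ)) :=
      memLp_one_iff_integrable.1 ((h j).memLpLoc_deriv _ hc hs)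
    have heq : ∀ m, ∫ x in tsupport φ, F m (f x) * partialDeriv j φ x
        = - ∫ x in tsupport φ, F' m (f x) * g j x * φ x := by
      intro m
      have := IsWeakPartialDeriv.integral_comp_eq hΩ (j := j) h (hF m) (hF'c m) (hFb m) (hF'1 m)
        hφ hc hs
      rwa [setIntegral_eq_setIntegral_tsupport hΩ hs fun x hx => by simp [z1 x hx],
        setIntegral_eq_setIntegral_tsupport hΩ hs fun x hx => by simp [z0 x hx]] at this
    have L1 : Tendsto (fun m => ∫ x in tsupport φ, F m (f x) * partialDeriv j φ x) atTop
        (𝓝 (∫ _x in tsupport φ, 0)) := by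
      refine tendsto_integral_of_dominated_convergence (fun _ => 2 * C') (fun m => ?_)
        (integrable_const _) (fun m => Eventually.of_forall fun x => ?_)
        (Eventually.of_forall fun x => ?_)
      · have hFc : Continuous (F m) := continuous_iff_continuousAt.2 fun t => (hF m t).continuousAt
        exact (hFc.comp_aestronglyMeasurable hfm).mul
          (continuous_partialDeriv hφ1 j).aestronglyMeasurable
      · rw [norm_mul]
        refine mul_le_mul ((hFb m _).trans ?_) (hC' x) (norm_nonneg _) (by norm_num)
        exact div_le_self (by norm_num) (by linarith [(Nat.cast_nonneg m : (0 : ℝ) ≤ m)])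
      · simpa using (hlimF (f x)).mul_const (partialDeriv j φ x)
    have L2 : Tendsto (fun m => ∫ x in tsupport φ, F' m (f x) * g j x * φ x) atTop
        (𝓝 (∫ x in tsupport φ, S x * g j x * φ x)) := by
      refine tendsto_integral_of_dominated_convergence (fun x => 1 * ‖g j x‖ * C) (fun m => ?_)
        ((hgi.norm.const_mul _).mul_const _) (fun m => Eventually.of_forall fun x => ?_)
        (Eventually.of_forall fun x => ?_)
      · exact (((hF'c m).comp_aestronglyMeasurable hfm).mul hgi.1).mul
          hφ.continuous.aestronglyMeasurable
      · rw [norm_mul, norm_mul]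
        gcongr
        · exact hF'1 m _
        · exact hC x
      · exact ((hlimF' x).mul_const _).mul_const _
    simp_rw [heq] at L1
    rw [integral_zero] at L1
    have := tendsto_nhds_unique L1 L2.neg
    linarith
  have hloc : LocallyIntegrableOn (fun x => S x * g j x) Ω volume :=
    (locallyIntegrableOn_iff hΩ.isLocallyClosed).2 fun K hKΩ hK => hgS K hK hKΩ
  have hzero := hΩ.ae_eq_zero_of_integral_contDiff_smul_eq_zero hloc (by
    intro φ hφ hc hs
    rw [← setIntegral_eq_integral_of_forall_compl_eq_zero (s := tsupport φ)
      (fun x hx => by simp [image_eq_zero_of_notMem_tsupport hx]), ← key φ hφ hc hs]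
    exact integral_congr_ae (Eventually.of_forall fun x => by simp [mul_comm]))
  rw [ae_restrict_iff' hΩ.measurableSet]
  filter_upwards [hzero] with x hx hxΩ hfx
  simpa [hS, hfx] using hx hxΩ

/-- A function with vanishing weak gradient is locally almost everywhere constant. -/
theorem exists_ae_eq_const_ball {Ω : Set (EuclideanSpace ℝ (Fin n))} (hΩ : IsOpen Ω)
    {f : EuclideanSpace ℝ (Fin n) → ℝ} (hf : MemLpLoc Ω 1 f)
    (h : ∀ j, IsWeakPartialDeriv Ω j f (fun _ => 0)) {x₀ : EuclideanSpace ℝ (Fin n)}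
    (hx₀ : x₀ ∈ Ω) : ∃ r > 0, Metric.ball x₀ r ⊆ Ω ∧ ∃ c : ℝ,
      ∀ᵐ x ∂(volume.restrict (Metric.ball x₀ r)), f x = c := by
  obtain ⟨R, hR, hRΩ⟩ := Metric.nhds_basis_closedBall.mem_iff.1 (hΩ.mem_nhds hx₀)
  set K := Metric.closedBall x₀ R with hKdef
  have hK : IsCompact K := isCompact_closedBall _ _
  have hr : 0 < R / 2 := by positivity
  refine ⟨R / 2, hr, (Metric.ball_subset_closedBall.trans
    (Metric.closedBall_subset_closedBall (by linarith))).trans hRΩ, ?_⟩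
  let φ : ℕ → ContDiffBump (0 : EuclideanSpace ℝ (Fin n)) := fun k =>
    { rIn := R / 2 / (k + 1) / 2
      rOut := R / 2 / (k + 1)
      rIn_pos := by positivity
      rIn_lt_rOut := half_lt_self (by positivity) }
  have hφ : Tendsto (fun k => (φ k).rOut) atTop (𝓝 0) :=
    tendsto_const_div_atTop_nhds_zero_nat (R / 2) |>.comp (tendsto_add_atTop_nat 1) |>.congr
      fun k => by simp [φ]
  have hφ2 : ∀ k, (φ k).rOut ≤ 2 * (φ k).rIn := fun k => by simp only [φ]; linarith
  have hφδ : ∀ k, (φ k).rOut ≤ R / 2 := fun k => by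
    simp only [φ]
    exact div_le_self hr.le (by linarith [(Nat.cast_nonneg k : (0 : ℝ) ≤ k)])
  have hfi : LocallyIntegrable (K.indicator f) volume :=
    (hf.memLp_indicator hK hRΩ).locallyIntegrable le_rfl
  let w : ℕ → EuclideanSpace ℝ (Fin n) → ℝ := fun k =>
    (φ k).normed volume ⋆[ContinuousLinearMap.lsmul ℝ ℝ, volume] K.indicator f
  have hw : ∀ k, ContDiff ℝ 1 (w k) := fun k =>
    (φ k).hasCompactSupport_normed.contDiff_convolution_left _ (φ k).contDiff_normed hfi
  have hpd : ∀ k, ∀ x ∈ Metric.ball x₀ (R / 2), fderiv ℝ (w k) x = 0 := by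
    intro k x hx
    have hsub : Metric.closedBall x (φ k).rOut ⊆ K :=
      Metric.closedBall_subset_closedBall' (by linarith [hφδ k, Metric.mem_ball.1 hx])
    have h1 : ∀ j, fderiv ℝ (w k) x (EuclideanSpace.single j 1) = 0 := by
      intro j
      have := (h j).partialDeriv_convolution hK hRΩ (φ k) hsub
      rw [partialDeriv] at this
      rw [this, convolution_lsmul_eq_integral_normed]
      simp
    refine ContinuousLinearMap.coe_injective ((EuclideanSpace.basisFun (Fin n) ℝ).toBasis.ext
      fun j => ?_)
    simpa using h1 j
  have hconst : ∀ k, ∀ x ∈ Metric.ball x₀ (R / 2), w k x = w k x₀ := by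
    intro k x hx
    exact Metric.isOpen_ball.is_const_of_fderiv_eq_zero (convex_ball _ _).isPreconnected
      ((hw k).differentiable (by simp)).differentiableOn (hpd k) hx (Metric.mem_ball_self hr)
  -- Each mollification is constant on the half ball, so `f x` is almost everywhere the limit of a
  -- sequence independent of `x`.
  have hae : ∀ᵐ x ∂(volume.restrict (Metric.ball x₀ (R / 2))),
      Tendsto (fun k => w k x₀) atTop (𝓝 (f x)) := by
    rw [ae_restrict_iff' measurableSet_ball]
    filter_upwards [ContDiffBump.ae_convolution_tendsto_right_of_locallyIntegrable hφ
      (Eventually.of_forall hφ2) hfi] with x hx hxB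
    have hxK : x ∈ K := Metric.closedBall_subset_closedBall (by linarith)
      (Metric.ball_subset_closedBall hxB)
    rw [Set.indicator_of_mem hxK] at hx
    exact hx.congr fun k => hconst k x hxB
  have hne : (ae (volume.restrict (Metric.ball x₀ (R / 2)))).NeBot := by
    rw [ae_restrict_neBot]
    exact (Metric.measure_ball_pos volume x₀ hr).ne'
  obtain ⟨y, hy⟩ := hae.exists
  exact ⟨f y, hae.mono fun x hx => tendsto_nhds_unique hx hy⟩

/-- A function with vanishing weak gradient on a domain is almost everywhere constant. -/
theorem exists_ae_eq_const_of_isPreconnected {Ω : Set (EuclideanSpace ℝ (Fin n))} (hΩ : IsOpen Ω)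
    (hconn : IsPreconnected Ω) {f : EuclideanSpace ℝ (Fin n) → ℝ} (hf : MemLpLoc Ω 1 f)
    (h : ∀ j, IsWeakPartialDeriv Ω j f (fun _ => 0)) :
    ∃ c : ℝ, ∀ᵐ x ∂(volume.restrict Ω), f x = c := by
  have hloc : ∀ x : Ω, ∃ r > 0, Metric.ball (x : EuclideanSpace ℝ (Fin n)) r ⊆ Ω ∧ ∃ c : ℝ,
      ∀ᵐ y ∂(volume.restrict (Metric.ball (x : EuclideanSpace ℝ (Fin n)) r)), f y = c :=
    fun x => exists_ae_eq_const_ball hΩ hf h x.2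
  choose r hr hrΩ c hc using hloc
  -- Overlapping balls meet in a nonempty open set, which has positive measure and forces their
  -- constants to agree.
  have huniq : ∀ x y : Ω, (y : EuclideanSpace ℝ (Fin n)) ∈ Metric.ball (x : EuclideanSpace ℝ (Fin n)) (r x) →
      c y = c x := by
    intro x y hy
    have ho : IsOpen (Metric.ball (x : EuclideanSpace ℝ (Fin n)) (r x) ∩
      Metric.ball (y : EuclideanSpace ℝ (Fin n)) (r y)) :=
      Metric.isOpen_ball.inter Metric.isOpen_ball
    have hne : (ae ((volume : Measure (EuclideanSpace ℝ (Fin n))).restrict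
        (Metric.ball (x : EuclideanSpace ℝ (Fin n)) (r x) ∩
          Metric.ball (y : EuclideanSpace ℝ (Fin n)) (r y)))).NeBot := by
      rw [ae_restrict_neBot]
      exact (ho.measure_pos volume ⟨y, hy, Metric.mem_ball_self (hr y)⟩).ne'
    obtain ⟨z, hz1, hz2⟩ := ((ae_restrict_of_ae_restrict_of_subset Set.inter_subset_left
      (hc x)).and (ae_restrict_of_ae_restrict_of_subset Set.inter_subset_right (hc y))).exists
    rw [← hz1, ← hz2]
  have hlc : IsLocallyConstant c := by
    rw [IsLocallyConstant.iff_exists_open]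
    intro x
    exact ⟨_, Metric.isOpen_ball.preimage continuous_subtype_val, Metric.mem_ball_self (hr x),
      fun y hy => huniq x y hy⟩
  have : PreconnectedSpace Ω := Subtype.preconnectedSpace hconn
  rcases Set.eq_empty_or_nonempty Ω with rfl | ⟨x₀, hx₀⟩
  · exact ⟨0, by simp⟩
  refine ⟨c ⟨x₀, hx₀⟩, ?_⟩
  have hcc : ∀ x, c x = c ⟨x₀, hx₀⟩ := fun x =>
    hlc.apply_eq_of_isPreconnected isPreconnected_univ (Set.mem_univ _) (Set.mem_univ _)
  rw [ae_iff, Measure.restrict_apply₀' hΩ.measurableSet.nullMeasurableSet]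
  refine measure_null_of_locally_null _ fun x hx => ?_
  refine ⟨_, inter_mem_nhdsWithin _ (Metric.ball_mem_nhds x (hr ⟨x, hx.2⟩)), ?_⟩
  have h1 := hc ⟨x, hx.2⟩
  rw [hcc, ae_iff, Measure.restrict_apply₀' measurableSet_ball.nullMeasurableSet] at h1
  exact measure_mono_null (Set.inter_subset_inter_left _ Set.inter_subset_left) h1

end Consequences

/-! ### Cofactor algebra and the Piola identity -/

section Cofactor

/-- This form exhibits the entry as multilinear in the rows other than `i`, which the Piola identity
differentiates one at a time. -/
theorem cof_apply (A : Matrix (Fin n) (Fin n) ℝ) (i j : Fin n) :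
    cof A i j = (A.updateRow i (Pi.single j 1)).det := by
  rw [cof, Matrix.transpose_apply, Matrix.adjugate_apply]

theorem transpose_mul_cof (A : Matrix (Fin n) (Fin n) ℝ) :
    A.transpose * cof A = A.det • (1 : Matrix (Fin n) (Fin n) ℝ) := by
  rw [cof, ← Matrix.transpose_mul, Matrix.adjugate_mul, Matrix.transpose_smul,
    Matrix.transpose_one]

theorem cof_mul_transpose (A : Matrix (Fin n) (Fin n) ℝ) :
    cof A * A.transpose = A.det • (1 : Matrix (Fin n) (Fin n) ℝ) := by
  rw [cof, ← Matrix.transpose_mul, Matrix.mul_adjugate, Matrix.transpose_smul,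
    Matrix.transpose_one]

theorem continuous_cof : Continuous (cof : Matrix (Fin n) (Fin n) ℝ → _) :=
  (continuous_id.matrix_adjugate).matrix_transpose

/-- An entry is a signed minor, a Leibniz sum of `(n-1)!` products of `n - 1` factors. This degree
is the source of the exponent `p / (n-1)`. -/
theorem abs_cof_le (A : Matrix (Fin n) (Fin n) ℝ) {C : ℝ} (hA : ∀ i j, |A i j| ≤ C)
    (i j : Fin n) : |cof A i j| ≤ (n - 1).factorial * C ^ (n - 1) := by
  cases n with
  | zero => exact i.elim0
  | succ m =>
    rw [cof, Matrix.transpose_apply, Matrix.adjugate_fin_succ_eq_det_submatrix, abs_mul, abs_pow,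
      abs_neg, abs_one, one_pow, one_mul]
    have := Matrix.det_le (abv := IsAbsoluteValue.toAbsoluteValue (abs : ℝ → ℝ))
      (A := A.submatrix i.succAbove j.succAbove) (x := C) fun a b => hA _ _
    simpa using this

/-- Swapping two prescribed rows of a determinant changes its sign. -/
theorem det_updateRow_updateRow_swap (A : Matrix (Fin n) (Fin n) ℝ) {i k : Fin n} (hik : i ≠ k)
    (v w : Fin n → ℝ) :
    ((A.updateRow i v).updateRow k w).det = -((A.updateRow i w).updateRow k v).det := by
  have h := Matrix.det_permute (Equiv.swap i k) ((A.updateRow i w).updateRow k v)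
  rw [Equiv.Perm.sign_swap hik] at h
  simp only [Units.val_neg, Units.val_one, Int.cast_neg, Int.cast_one, neg_mul, one_mul] at h
  rw [← h]
  congr 1
  ext a b
  rcases eq_or_ne a i with rfl | hai
  · simp [Matrix.updateRow_apply, hik]
  rcases eq_or_ne a k with rfl | hak
  · simp [Matrix.updateRow_apply, hik]
  · simp [Matrix.updateRow_apply, hai, hak, Equiv.swap_apply_of_ne_of_ne hai hak]

/-- The gradient matrix of a family of scalar functions. -/
noncomputable def gradMatrix (w : Fin n → EuclideanSpace ℝ (Fin n) → ℝ)
    (x : EuclideanSpace ℝ (Fin n)) : Matrix (Fin n) (Fin n) ℝ :=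
  Matrix.of fun i j => partialDeriv j (w i) x

theorem contDiff_cof_gradMatrix {w : Fin n → EuclideanSpace ℝ (Fin n) → ℝ}
    (hw : ∀ i, ContDiff ℝ ∞ (w i)) (i j : Fin n) :
    ContDiff ℝ ∞ fun x => cof (gradMatrix w x) i j := by
  simp_rw [cof_apply, Matrix.det_apply]
  refine ContDiff.sum fun σ _ => ContDiff.const_smul _ (contDiff_prod fun l _ => ?_)
  simp only [Matrix.updateRow_apply]
  split_ifs
  · exact contDiff_const
  · exact contDiff_partialDeriv (hw _) _

theorem partialDeriv_comm {f : EuclideanSpace ℝ (Fin n) → ℝ} (hf : ContDiff ℝ ∞ f)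
    (j l : Fin n) (x : EuclideanSpace ℝ (Fin n)) :
    partialDeriv j (partialDeriv l f) x = partialDeriv l (partialDeriv j f) x := by
  have hd : DifferentiableAt ℝ (fderiv ℝ f) x :=
    (hf.fderiv_right (m := ∞) (by simp)).differentiable (by simp) x
  have h1 : ∀ a b : Fin n, partialDeriv a (partialDeriv b f) x
      = fderiv ℝ (fderiv ℝ f) x (EuclideanSpace.single a 1) (EuclideanSpace.single b 1) := by
    intro a b
    have := hd.hasFDerivAt.clm_apply (hasFDerivAt_const (EuclideanSpace.single b (1 : ℝ)) x)
    have h2 : HasFDerivAt (partialDeriv b f) _ x := this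
    rw [partialDeriv, h2.fderiv]
    simp
  rw [h1, h1]
  have hs : IsSymmSndFDerivAt ℝ f x :=
    hf.contDiffAt.isSymmSndFDerivAt (by
      rw [minSmoothness_of_isRCLikeNormedField]
      exact WithTop.coe_le_coe.2 le_top)
  exact hs _ _

/-- The **Piola identity**: the rows of the cofactor matrix of a gradient are divergence free. -/
theorem sum_partialDeriv_cof_gradMatrix {w : Fin n → EuclideanSpace ℝ (Fin n) → ℝ}
    (hw : ∀ i, ContDiff ℝ ∞ (w i)) (i : Fin n) (x : EuclideanSpace ℝ (Fin n)) :
    ∑ j, partialDeriv j (fun y => cof (gradMatrix w y) i j) x = 0 := by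
  let f : ContinuousMultilinearMap ℝ (fun _ : Fin n => Fin n → ℝ) ℝ :=
    { (Matrix.detRowAlternating : (Fin n → ℝ) [⋀^Fin n]→ₗ[ℝ] ℝ).toMultilinearMap with
      cont := Continuous.matrix_det (A := fun A : Matrix (Fin n) (Fin n) ℝ => A) continuous_id }
  let S : Fin n → Fin n → Fin n → ℝ := fun k l j => partialDeriv j (partialDeriv l (w k)) x
  have hS : ∀ k l j, S k l j = S k j l := fun k l j => partialDeriv_comm (hw k) j l x
  let A := gradMatrix w x
  have hder : ∀ j, partialDeriv j (fun y => cof (gradMatrix w y) i j) x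
      = ∑ k ∈ Finset.univ.erase i, ∑ l, S k l j *
        ((A.updateRow i (Pi.single j 1)).updateRow k (Pi.single l 1)).det := by
    intro j
    let r : Fin n → EuclideanSpace ℝ (Fin n) → Fin n → ℝ := fun k y =>
      (gradMatrix w y).updateRow i (Pi.single j 1) k
    let r' : Fin n → EuclideanSpace ℝ (Fin n) →L[ℝ] Fin n → ℝ := fun k =>
      if k = i then 0 else ContinuousLinearMap.pi fun l => fderiv ℝ (partialDeriv l (w k)) x
    have hr : ∀ k, HasFDerivAt (r k) (r' k) x := by
      intro k
      by_cases hk : k = i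
      · have : r k = fun _ => Pi.single j 1 := by
          funext y; simp [r, hk]
        rw [this]
        simp only [r', hk, if_true]
        exact hasFDerivAt_const _ _
      · have : r k = fun y l => partialDeriv l (w k) y := by
          funext y l; simp [r, hk, gradMatrix]
        rw [this]
        simp only [r', hk, if_false]
        exact hasFDerivAt_pi.2 fun l =>
          ((contDiff_partialDeriv (hw k) l).differentiable (by simp) x).hasFDerivAt
    have h1 := HasFDerivAt.multilinear_comp f hr
    have h2 : HasFDerivAt (fun y => cof (gradMatrix w y) i j) _ x :=
      h1.congr_of_eventuallyEq (Eventually.of_forall fun y => by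
        exact cof_apply _ i j)
    rw [partialDeriv, h2.fderiv, _root_.sum_apply,
      ← Finset.add_sum_erase _ _ (Finset.mem_univ i)]
    -- Row `i` is the constant vector `e_j`, so its term in the product rule vanishes.
    have hi0 : (f.toContinuousLinearMap (fun k => r k x) i ∘L r' i)
        (EuclideanSpace.single j 1) = 0 := by
      simp [r']
    rw [hi0, zero_add]
    refine Finset.sum_congr rfl fun k hk => ?_
    have hki : k ≠ i := Finset.ne_of_mem_erase hk
    have hv : r' k (EuclideanSpace.single j 1) = ∑ l, S k l j • (Pi.single l 1 : Fin n → ℝ) := by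
      funext l
      simp [r', hki, S, partialDeriv, Finset.sum_apply, Pi.single_apply]
    rw [ContinuousLinearMap.comp_apply, hv, map_sum]
    refine Finset.sum_congr rfl fun l _ => ?_
    rw [map_smul, smul_eq_mul]
    rfl
  simp_rw [hder]
  rw [Finset.sum_comm]
  refine Finset.sum_eq_zero fun k hk => ?_
  have hik : i ≠ k := (Finset.ne_of_mem_erase hk).symm
  -- Second derivatives are symmetric in `j, l` and the determinant is antisymmetric in them, so the
  -- double sum is its own negative.
  have hanti : ∑ j, ∑ l, S k l j *
        ((A.updateRow i (Pi.single j 1)).updateRow k (Pi.single l 1)).det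
      = - ∑ j, ∑ l, S k l j *
        ((A.updateRow i (Pi.single j 1)).updateRow k (Pi.single l 1)).det := by
    conv_lhs => rw [Finset.sum_comm]
    rw [← Finset.sum_neg_distrib]
    refine Finset.sum_congr rfl fun l _ => ?_
    rw [← Finset.sum_neg_distrib]
    refine Finset.sum_congr rfl fun j _ => ?_
    rw [hS, det_updateRow_updateRow_swap A hik]
    ring
  linarith

end Cofactor

/-- For finite `p` the inverses are `(n-1)/p` and `(p-(n-1))/p`, with sum one. At `p = n - 1` the
second is zero, so this endpoint needs no separate treatment. -/
theorem holderConjugate_div_pBar (hn : 2 ≤ n) {p : ℝ≥0∞} (hp : (n : ℝ≥0∞) - 1 ≤ p) :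
    ENNReal.HolderConjugate (p / ((n - 1 : ℕ) : ℝ≥0∞)) (pBar n p) := by
  obtain ⟨m, rfl⟩ : ∃ m, n = m + 1 := ⟨n - 1, by omega⟩
  have hm : m ≠ 0 := by omega
  have hm0 : (m : ℝ≥0∞) ≠ 0 := by exact_mod_cast hm
  have hmt : (m : ℝ≥0∞) ≠ ⊤ := ENNReal.natCast_ne_top m
  rw [Nat.cast_add, Nat.cast_one, ENNReal.add_sub_cancel_right ENNReal.one_ne_top] at hp
  rw [Nat.add_sub_cancel, pBar]
  split_ifs with h
  · rw [h, ENNReal.top_div_of_ne_top hmt]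
    infer_instance
  · have hp0 : p ≠ 0 := fun h0 => hm0 (by simpa [h0] using hp)
    rw [ENNReal.holderConjugate_iff, ENNReal.inv_div (Or.inl hmt) (Or.inl hm0),
      ENNReal.inv_div (Or.inr h) (Or.inr hp0), Nat.cast_add, Nat.cast_one,
      tsub_add_eq_tsub_tsub_swap, ENNReal.add_sub_cancel_right ENNReal.one_ne_top,
      ← ENNReal.add_div, add_tsub_cancel_of_le hp, ENNReal.div_self hp0 h]

/-! ### Case (b): Sobolev solutions and injective `h` -/

section SobolevCase

/-- Integration by parts against the divergence free rows of the cofactor matrix of a smooth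
map. -/
theorem IsWeakPartialDeriv.integral_mul_cof_gradMatrix {Ω : Set (EuclideanSpace ℝ (Fin n))}
    (hΩ : IsOpen Ω) {H : EuclideanSpace ℝ (Fin n) → ℝ}
    {g : Fin n → EuclideanSpace ℝ (Fin n) → ℝ} (h : ∀ j, IsWeakPartialDeriv Ω j H (g j))
    {w : Fin n → EuclideanSpace ℝ (Fin n) → ℝ} (hw : ∀ i, ContDiff ℝ ∞ (w i)) (i : Fin n)
    {φ : EuclideanSpace ℝ (Fin n) → ℝ} (hφ : ContDiff ℝ ∞ φ) (hc : HasCompactSupport φ)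
    (hs : tsupport φ ⊆ Ω) :
    ∫ x in tsupport φ, H x * ∑ j, cof (gradMatrix w x) i j * partialDeriv j φ x
      = - ∫ x in tsupport φ, (∑ j, g j x * cof (gradMatrix w x) i j) * φ x := by
  have hcof : ∀ j, ContDiff ℝ ∞ fun x => cof (gradMatrix w x) i j :=
    fun j => contDiff_cof_gradMatrix hw i j
  -- With these as test functions, one for each direction, the derivatives falling on the cofactors
  -- sum to zero by Piola.
  let ψ : Fin n → EuclideanSpace ℝ (Fin n) → ℝ := fun j x => cof (gradMatrix w x) i j * φ x
  have hψ : ∀ j, ContDiff ℝ ∞ (ψ j) := fun j => (hcof j).mul hφ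
  have z0 : ∀ x, x ∉ tsupport φ → φ x = 0 := fun x hx => image_eq_zero_of_notMem_tsupport hx
  have hψsub : ∀ j, tsupport (ψ j) ⊆ tsupport φ := fun j =>
    closure_minimal (fun x hx => by
      by_contra h0
      exact hx (by simp [ψ, z0 x h0])) (isClosed_tsupport _)
  have hψc : ∀ j, HasCompactSupport (ψ j) := fun j =>
    hc.isCompact.of_isClosed_subset (isClosed_tsupport _) (hψsub j)
  have hpd : ∀ x, ∑ j, partialDeriv j (ψ j) x
      = ∑ j, cof (gradMatrix w x) i j * partialDeriv j φ x := by
    intro x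
    have h1 : ∀ j, partialDeriv j (ψ j) x = cof (gradMatrix w x) i j * partialDeriv j φ x
        + φ x * partialDeriv j (fun y => cof (gradMatrix w y) i j) x := by
      intro j
      have h2 : HasFDerivAt (ψ j) _ x := (((hcof j).differentiable (by simp) x).hasFDerivAt).mul
        ((hφ.differentiable (by simp) x).hasFDerivAt)
      rw [partialDeriv, h2.fderiv]
      simp [partialDeriv]
    simp_rw [h1]
    rw [Finset.sum_add_distrib, ← Finset.mul_sum, sum_partialDeriv_cof_gradMatrix hw, mul_zero,
      add_zero]
  have hHi : Integrable H (volume.restrict (tsupport φ)) ∨ n = 0 := by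
    rcases Nat.eq_zero_or_pos n with h0 | h0
    · exact Or.inr h0
    · exact Or.inl (memLp_one_iff_integrable.1 ((h ⟨0, h0⟩).memLpLoc_fun _ hc hs))
  rcases hHi with hHi | rfl
  swap
  · exact i.elim0
  have hgi : ∀ j, Integrable (g j) (volume.restrict (tsupport φ)) := fun j =>
    memLp_one_iff_integrable.1 ((h j).memLpLoc_deriv _ hc hs)
  have e1 : ∀ j, ∫ x in tsupport φ, H x * partialDeriv j (ψ j) x
      = - ∫ x in tsupport φ, g j x * cof (gradMatrix w x) i j * φ x := by
    intro j
    have := (h j).integral_eq (ψ j) (hψ j) (hψc j) ((hψsub j).trans hs)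
    rw [setIntegral_eq_setIntegral_tsupport hΩ hs fun x hx => by
        simp [partialDeriv_eq_zero_of_notMem_tsupport (fun h' => hx (hψsub j h'))],
      setIntegral_eq_setIntegral_tsupport hΩ hs fun x hx => by simp [ψ, z0 x hx]] at this
    rw [this]
    simp only [ψ, mul_assoc]
  have i1 : ∀ j, Integrable (fun x => H x * partialDeriv j (ψ j) x)
      (volume.restrict (tsupport φ)) := fun j =>
    IntegrableOn.mul_continuousOn hHi
      (continuous_partialDeriv ((hψ j).of_le (by simp)) j).continuousOn hc
  have i2 : ∀ j, Integrable (fun x => g j x * cof (gradMatrix w x) i j * φ x)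
      (volume.restrict (tsupport φ)) := fun j =>
    IntegrableOn.mul_continuousOn (IntegrableOn.mul_continuousOn (hgi j)
      (hcof j).continuous.continuousOn hc) hφ.continuous.continuousOn hc
  simp_rw [← hpd, Finset.mul_sum, Finset.sum_mul]
  rw [integral_finsetSum _ fun j _ => i1 j, integral_finsetSum _ fun j _ => i2 j,
    ← Finset.sum_neg_distrib]
  exact Finset.sum_congr rfl fun j _ => e1 j

/-- Integration by parts against the cofactor matrix of a Sobolev map: the rows of `cof Du` are
weakly divergence free. -/
theorem integral_mul_cof_eq (hn : 2 ≤ n) {Ω : Set (EuclideanSpace ℝ (Fin n))} (hΩ : IsOpen Ω)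
    {p : ℝ≥0∞} (hp : (n : ℝ≥0∞) - 1 ≤ p)
    {u : EuclideanSpace ℝ (Fin n) → EuclideanSpace ℝ (Fin n)}
    {Du : EuclideanSpace ℝ (Fin n) → Matrix (Fin n) (Fin n) ℝ} (hu : IsWeakJacobian Ω u Du)
    (hDu : ∀ i j, MemLpLoc Ω p fun x => Du x i j) {H : EuclideanSpace ℝ (Fin n) → ℝ}
    {g : Fin n → EuclideanSpace ℝ (Fin n) → ℝ} (hH : MemLpLoc Ω (pBar n p) H)
    (hg : ∀ j, MemLpLoc Ω (pBar n p) (g j)) (h : ∀ j, IsWeakPartialDeriv Ω j H (g j))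
    (i : Fin n) {φ : EuclideanSpace ℝ (Fin n) → ℝ} (hφ : ContDiff ℝ ∞ φ)
    (hc : HasCompactSupport φ) (hs : tsupport φ ⊆ Ω) :
    (∀ j, Integrable (fun x => g j x * cof (Du x) i j) (volume.restrict (tsupport φ))) ∧
    ∫ x in tsupport φ, H x * ∑ j, cof (Du x) i j * partialDeriv j φ x
      = - ∫ x in tsupport φ, (∑ j, g j x * cof (Du x) i j) * φ x := by
  have hφ1 : ContDiff ℝ 1 φ := hφ.of_le (by simp)
  have hm : 1 ≤ n - 1 := by omega
  have hp1 : 1 ≤ p := by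
    refine le_trans ?_ hp
    have : (n : ℝ≥0∞) - 1 = ((n - 1 : ℕ) : ℝ≥0∞) := by norm_cast
    rw [this]
    exact_mod_cast hm
  have hconj := holderConjugate_div_pBar hn hp
  obtain ⟨w, hw, -, hwg, G, hG, hdom⟩ := exists_smooth_approx (ι := Fin n) hΩ hc hs hp1
    (fun i => (hu i i).memLpLoc_fun) hu hDu
  obtain ⟨C, hC⟩ := hc.exists_bound_of_continuous hφ.continuous
  have z1 : ∀ j x, x ∉ tsupport φ → partialDeriv j φ x = 0 :=
    fun j x hx => partialDeriv_eq_zero_of_notMem_tsupport hx j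
  have hC'ex : ∀ j, ∃ C', ∀ x, ‖partialDeriv j φ x‖ ≤ C' := fun j =>
    (show HasCompactSupport (partialDeriv j φ) from
      HasCompactSupport.intro hc (z1 j)).exists_bound_of_continuous (continuous_partialDeriv hφ1 j)
  choose C' hC' using hC'ex
  -- A majorant of all cofactors in row `i`, lying in the dual space of `H` and `g j`; its products
  -- with them are the dominating functions below.
  set P : EuclideanSpace ℝ (Fin n) → ℝ := fun x => (n - 1).factorial * G x ^ (n - 1) with hP
  have hPmem : MemLp P (p / ((n - 1 : ℕ) : ℝ≥0∞)) (volume.restrict (tsupport φ)) := by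
    have h1 := (hG.norm_rpow_div ((n - 1 : ℕ) : ℝ≥0∞)).const_mul ((n - 1).factorial : ℝ)
    refine h1.congr_norm ?_ (Eventually.of_forall fun x => ?_)
    · exact (hG.1.pow _).const_mul _
    · simp only [hP, ENNReal.toReal_natCast, Real.rpow_natCast, norm_mul, norm_pow, norm_norm]
  have hpt : ∀ k, ∀ᵐ x ∂(volume.restrict (tsupport φ)), ∀ j,
      |cof (gradMatrix (w k) x) i j| ≤ P x := by
    intro k
    have : ∀ᵐ x ∂(volume.restrict (tsupport φ)), ∀ a b, |gradMatrix (w k) x a b| ≤ G x := by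
      rw [ae_all_iff]; intro a
      rw [ae_all_iff]; intro b
      exact hdom k a b
    filter_upwards [this] with x hx j
    exact abs_cof_le _ hx i j
  have hlim : ∀ᵐ x ∂(volume.restrict (tsupport φ)), ∀ j,
      Tendsto (fun k => cof (gradMatrix (w k) x) i j) atTop (𝓝 (cof (Du x) i j)) := by
    have : ∀ᵐ x ∂(volume.restrict (tsupport φ)), ∀ a b,
        Tendsto (fun k => gradMatrix (w k) x a b) atTop (𝓝 (Du x a b)) := by
      rw [ae_all_iff]; intro a
      rw [ae_all_iff]; intro b
      exact hwg a b
    filter_upwards [this] with x hx j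
    have h1 : Tendsto (fun k => gradMatrix (w k) x) atTop (𝓝 (Du x)) :=
      tendsto_pi_nhds.2 fun a => tendsto_pi_nhds.2 fun b => hx a b
    have h2 := (continuous_cof.tendsto (Du x)).comp h1
    exact tendsto_pi_nhds.1 (tendsto_pi_nhds.1 h2 i) j
  have hcofc : ∀ k j, Continuous fun x => cof (gradMatrix (w k) x) i j := fun k j =>
    (contDiff_cof_gradMatrix (hw k) i j).continuous
  have hHK := hH _ hc hs
  have hgK := fun j => hg j _ hc hs
  have hHP : Integrable (fun x => |H x| * P x) (volume.restrict (tsupport φ)) := by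
    have := hPmem.integrable_mul hHK.abs
    exact this.congr (Eventually.of_forall fun x => mul_comm _ _)
  have hgP : ∀ j, Integrable (fun x => |g j x| * P x) (volume.restrict (tsupport φ)) := by
    intro j
    have := hPmem.integrable_mul (hgK j).abs
    exact this.congr (Eventually.of_forall fun x => mul_comm _ _)
  have hP0 : ∀ᵐ x ∂(volume.restrict (tsupport φ)), ∀ j, |cof (Du x) i j| ≤ P x := by
    filter_upwards [hlim, ae_all_iff.2 hpt] with x h1 h2 j
    exact le_of_tendsto (h1 j).abs (Eventually.of_forall fun k => h2 k j)
  have hcm : ∀ j, AEStronglyMeasurable (fun x => cof (Du x) i j)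
      (volume.restrict (tsupport φ)) := fun j =>
    aestronglyMeasurable_of_tendsto_ae atTop (fun k => (hcofc k j).aestronglyMeasurable)
      (hlim.mono fun x hx => hx j)
  refine ⟨fun j => (hgP j).mono' ((hgK j).1.mul (hcm j)) ?_, ?_⟩
  · filter_upwards [hP0] with x hx
    rw [norm_mul]
    exact mul_le_mul_of_nonneg_left (hx j) (abs_nonneg _)
  have L1 : Tendsto (fun k => ∫ x in tsupport φ,
      H x * ∑ j, cof (gradMatrix (w k) x) i j * partialDeriv j φ x) atTop
      (𝓝 (∫ x in tsupport φ, H x * ∑ j, cof (Du x) i j * partialDeriv j φ x)) := by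
    refine tendsto_integral_of_dominated_convergence (fun x => |H x| * P x * ∑ j, C' j)
      (fun k => ?_) (hHP.mul_const _) (fun k => ?_) ?_
    · exact hHK.1.mul (continuous_finsetSum _ fun j _ =>
        (hcofc k j).mul (continuous_partialDeriv hφ1 j)).aestronglyMeasurable
    · filter_upwards [hpt k] with x hx
      rw [norm_mul, mul_assoc, Finset.mul_sum]
      refine mul_le_mul_of_nonneg_left ((norm_sum_le _ _).trans
        (Finset.sum_le_sum fun j _ => ?_)) (abs_nonneg _)
      rw [norm_mul]
      exact mul_le_mul (hx j) (hC' j x) (norm_nonneg _) ((abs_nonneg _).trans (hx j))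
    · filter_upwards [hlim] with x hx
      exact (tendsto_finsetSum _ fun j _ => (hx j).mul_const _).const_mul _
  have L2 : Tendsto (fun k => ∫ x in tsupport φ,
      (∑ j, g j x * cof (gradMatrix (w k) x) i j) * φ x) atTop
      (𝓝 (∫ x in tsupport φ, (∑ j, g j x * cof (Du x) i j) * φ x)) := by
    refine tendsto_integral_of_dominated_convergence (fun x => (∑ j, |g j x| * P x) * C)
      (fun k => ?_) ((integrable_finsetSum _ fun j _ => hgP j).mul_const _) (fun k => ?_) ?_
    · exact (Finset.aestronglyMeasurable_fun_sum _ fun j _ =>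
        (hgK j).1.mul (hcofc k j).aestronglyMeasurable).mul hφ.continuous.aestronglyMeasurable
    · filter_upwards [hpt k] with x hx
      rw [norm_mul]
      have hterm : ∀ j, ‖g j x * cof (gradMatrix (w k) x) i j‖ ≤ |g j x| * P x := fun j => by
        rw [norm_mul]
        exact mul_le_mul_of_nonneg_left (hx j) (abs_nonneg _)
      refine mul_le_mul ((norm_sum_le _ _).trans (Finset.sum_le_sum fun j _ => hterm j)) (hC x)
        (norm_nonneg _) (Finset.sum_nonneg fun j _ => (norm_nonneg _).trans (hterm j))
    · filter_upwards [hlim] with x hx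
      exact (tendsto_finsetSum _ fun j _ => (hx j).const_mul _).mul_const _
  refine tendsto_nhds_unique L1 ?_
  simp_rw [IsWeakPartialDeriv.integral_mul_cof_gradMatrix hΩ h (hw _) i hφ hc hs]
  exact L2.neg

/-- The weak form of `div (h(det Du) cof Du) = 0`, tested componentwise. -/
theorem IsWeakSolution.integral_component_eq_zero {Ω : Set (EuclideanSpace ℝ (Fin n))} {h : ℝ → ℝ}
    {u : EuclideanSpace ℝ (Fin n) → EuclideanSpace ℝ (Fin n)}
    {Du : EuclideanSpace ℝ (Fin n) → Matrix (Fin n) (Fin n) ℝ} (hu : IsWeakSolution Ω h u Du)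
    (i : Fin n) {φ : EuclideanSpace ℝ (Fin n) → ℝ} (hφ : ContDiff ℝ 1 φ)
    (hc : HasCompactSupport φ) (hs : tsupport φ ⊆ Ω) :
    ∫ x in Ω, h (Du x).det * ∑ j, cof (Du x) i j * partialDeriv j φ x = 0 := by
  let ζ : EuclideanSpace ℝ (Fin n) → EuclideanSpace ℝ (Fin n) := fun x =>
    φ x • EuclideanSpace.single i 1
  have hζ : ContDiff ℝ 1 ζ := hφ.smul contDiff_const
  have hsub : tsupport ζ ⊆ tsupport φ := closure_minimal (fun x hx => by
    by_contra h0
    exact hx (by simp [ζ, image_eq_zero_of_notMem_tsupport h0])) (isClosed_tsupport _)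
  rw [← hu.integral_eq_zero ζ hζ (hc.isCompact.of_isClosed_subset (isClosed_tsupport _) hsub)
    (hsub.trans hs)]
  refine integral_congr_ae (Eventually.of_forall fun x => ?_)
  have hj : ∀ a j, jacobian ζ x a j = if a = i then partialDeriv j φ x else 0 := by
    intro a j
    rw [jacobian, Matrix.of_apply]
    split_ifs with ha
    · have : (fun y => ζ y a) = φ := by funext y; simp [ζ, ha]
      rw [this]
    · have : (fun y => ζ y a) = fun _ => 0 := by funext y; simp [ζ, ha]
      rw [this]
      simp [partialDeriv]
  simp only [frob, hj]
  refine Eq.symm ((Finset.sum_eq_single i (fun a _ ha => by simp [ha]) (by simp)).trans ?_)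
  simp [Finset.mul_sum, mul_assoc]

/-- If `h` is one-to-one and `h(det Du)` is weakly differentiable with the dual integrability,
then `det Du` is constant. -/
theorem IsWeakSolution.exists_ae_det_eq_of_injective (hn : 2 ≤ n)
    {Ω : Set (EuclideanSpace ℝ (Fin n))} (hΩ : IsOpen Ω) (hconn : IsConnected Ω) {h : ℝ → ℝ}
    {u : EuclideanSpace ℝ (Fin n) → EuclideanSpace ℝ (Fin n)}
    {Du : EuclideanSpace ℝ (Fin n) → Matrix (Fin n) (Fin n) ℝ} (hu : IsWeakSolution Ω h u Du)
    {p : ℝ≥0∞} (hp : (n : ℝ≥0∞) - 1 ≤ p) (hup : MemW1LocVec Ω p u)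
    (hhp : MemW1Loc Ω (pBar n p) fun x => h (Du x).det) (hinj : Function.Injective h) :
    ∃ c : ℝ, ∀ᵐ x ∂(volume.restrict Ω), (Du x).det = c := by
  obtain ⟨hH, hgex⟩ := hhp
  choose g hg hw using hgex
  -- The Sobolev hypothesis gives integrability of some weak derivative; uniqueness transfers it to
  -- `Du`.
  have hDu : ∀ i j, MemLpLoc Ω p fun x => Du x i j := by
    intro i j
    obtain ⟨v, hv, hv'⟩ := (hup i).2 j
    intro K hK hKΩ
    exact (hv K hK hKΩ).ae_eq (ae_restrict_of_ae_restrict_of_subset hKΩ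
      (hv'.ae_eq hΩ (hu.isWeakJacobian i j)))
  have hint : ∀ i (φ : EuclideanSpace ℝ (Fin n) → ℝ), ContDiff ℝ ∞ φ → HasCompactSupport φ →
      tsupport φ ⊆ Ω → ∫ x in tsupport φ, (∑ j, g j x * cof (Du x) i j) * φ x = 0 := by
    intro i φ hφ hc hs
    have h1 := (integral_mul_cof_eq hn hΩ hp hu.isWeakJacobian hDu hH hg hw i hφ hc hs).2
    have h2 := hu.integral_component_eq_zero i (hφ.of_le (by simp)) hc hs
    rw [setIntegral_eq_setIntegral_tsupport hΩ hs fun x hx => by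
      simp [partialDeriv_eq_zero_of_notMem_tsupport hx]] at h2
    linarith
  have hloc : ∀ i, LocallyIntegrableOn (fun x => ∑ j, g j x * cof (Du x) i j) Ω volume := by
    intro i
    refine (locallyIntegrableOn_iff hΩ.isLocallyClosed).2 fun K hKΩ hK => ?_
    -- Integrability was obtained only on supports of test functions, so `K` is enclosed in one.
    obtain ⟨φ, hφ1, hφs, hφc, hφ⟩ : ∃ φ : EuclideanSpace ℝ (Fin n) → ℝ, K ⊆ tsupport φ ∧
        tsupport φ ⊆ Ω ∧ HasCompactSupport φ ∧ ContDiff ℝ ∞ φ := by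
      obtain ⟨δ, hδ, hδΩ⟩ := hK.exists_cthickening_subset_open hΩ hKΩ
      obtain ⟨φ, hφ, hφd, -⟩ := (Metric.isOpen_thickening (δ := δ) (E := K)).exists_contDiff_support_eq
        (n := ⊤)
      have hts : tsupport φ ⊆ Metric.cthickening δ K := by
        rw [tsupport, hφ]
        exact Metric.closure_thickening_subset_cthickening δ K
      refine ⟨φ, ?_, hts.trans hδΩ,
        hK.cthickening.of_isClosed_subset (isClosed_tsupport _) hts, hφd⟩
      refine (Metric.self_subset_thickening hδ K).trans ?_
      rw [← hφ]
      exact subset_tsupport φ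
    have := fun j =>
      (integral_mul_cof_eq hn hΩ hp hu.isWeakJacobian hDu hH hg hw i hφ hφc hφs).1 j
    exact (integrable_finsetSum _ fun j _ => this j).mono_measure (Measure.restrict_mono hφ1 le_rfl)
  have hzero : ∀ᵐ x ∂(volume.restrict Ω), ∀ i, ∑ j, g j x * cof (Du x) i j = 0 := by
    rw [ae_all_iff]
    intro i
    rw [ae_restrict_iff' hΩ.measurableSet]
    refine hΩ.ae_eq_zero_of_integral_contDiff_smul_eq_zero (hloc i) fun φ hφ hc hs => ?_
    rw [← setIntegral_eq_integral_of_forall_compl_eq_zero (s := tsupport φ)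
      (fun x hx => by simp [image_eq_zero_of_notMem_tsupport hx]), ← hint i φ hφ hc hs]
    exact integral_congr_ae (Eventually.of_forall fun x => by simp [mul_comm])
  have hgrad : ∀ j, ∀ᵐ x ∂(volume.restrict Ω), g j x = 0 := by
    intro j
    -- The set `det Du = 0`, where the cofactor matrix need not be invertible, lies in the level set
    -- of `H` at `h 0`. Elsewhere multiplication by the transpose of `Du` recovers the gradient.
    filter_upwards [hzero, IsWeakPartialDeriv.ae_eq_zero_of_eq hΩ hw (h 0) j] with x hx hx0
    by_cases hdet : (Du x).det = 0
    · exact hx0 (by rw [hdet])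
    · have h1 : (cof (Du x)).mulVec (fun j => g j x) = 0 := by
        funext i
        rw [Matrix.mulVec, dotProduct, Pi.zero_apply, ← hx i]
        exact Finset.sum_congr rfl fun j _ => mul_comm _ _
      have h2 := congrArg ((Du x).transpose.mulVec) h1
      rw [Matrix.mulVec_mulVec, transpose_mul_cof, Matrix.mulVec_zero, Matrix.smul_mulVec,
        Matrix.one_mulVec] at h2
      have h3 := congrFun h2 j
      simpa [hdet] using h3
  obtain ⟨c, hc⟩ := exists_ae_eq_const_of_isPreconnected hΩ hconn.isPreconnected
    (hw ⟨0, by omega⟩).memLpLoc_fun fun j => (hw j).congr_deriv (hgrad j)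
  have hne : (ae (volume.restrict Ω)).NeBot := by
    rw [ae_restrict_neBot]
    exact (hΩ.measure_pos volume hconn.nonempty).ne'
  obtain ⟨y, hy⟩ := hc.exists
  exact ⟨(Du y).det, hc.mono fun x hx => hinj (hx.trans hy.symm)⟩

end SobolevCase

/-! ### Case (a): `C¹` solutions -/

section SmoothCase

theorem jacobian_apply_of_differentiableAt
    {u : EuclideanSpace ℝ (Fin n) → EuclideanSpace ℝ (Fin n)} {x : EuclideanSpace ℝ (Fin n)}
    (hu : DifferentiableAt ℝ u x) (i j : Fin n) :
    jacobian u x i j = fderiv ℝ u x (EuclideanSpace.single j 1) i := by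
  have h : HasFDerivAt (fun y => u y i) _ x :=
    (EuclideanSpace.proj (𝕜 := ℝ) i).hasFDerivAt.comp x hu.hasFDerivAt
  rw [jacobian, Matrix.of_apply, partialDeriv, h.fderiv]
  rfl

theorem det_fderiv_eq_det_jacobian
    {u : EuclideanSpace ℝ (Fin n) → EuclideanSpace ℝ (Fin n)} {x : EuclideanSpace ℝ (Fin n)}
    (hu : DifferentiableAt ℝ u x) : (fderiv ℝ u x).det = (jacobian u x).det := by
  rw [ContinuousLinearMap.det,
    ← LinearMap.det_toMatrix (EuclideanSpace.basisFun (Fin n) ℝ).toBasis]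
  congr 1
  ext i j
  rw [jacobian_apply_of_differentiableAt hu, LinearMap.toMatrix_apply]
  simp

theorem continuousOn_jacobian {Ω : Set (EuclideanSpace ℝ (Fin n))} (hΩ : IsOpen Ω)
    {u : EuclideanSpace ℝ (Fin n) → EuclideanSpace ℝ (Fin n)} (hu : ContDiffOn ℝ 1 u Ω) :
    ContinuousOn (jacobian u) Ω := by
  refine continuousOn_pi.2 fun i => continuousOn_pi.2 fun j => ?_
  have hui : ContDiffOn ℝ 1 (fun x => u x i) Ω :=
    (EuclideanSpace.proj (𝕜 := ℝ) i).contDiff.comp_contDiffOn hu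
  exact (hui.continuousOn_fderiv_of_isOpen hΩ le_rfl).clm_apply continuousOn_const

theorem IsWeakJacobian.ae_eq_jacobian {Ω : Set (EuclideanSpace ℝ (Fin n))} (hΩ : IsOpen Ω)
    {u : EuclideanSpace ℝ (Fin n) → EuclideanSpace ℝ (Fin n)}
    {Du : EuclideanSpace ℝ (Fin n) → Matrix (Fin n) (Fin n) ℝ} (hDu : IsWeakJacobian Ω u Du)
    (hu : ContDiffOn ℝ 1 u Ω) : ∀ᵐ x ∂(volume.restrict Ω), Du x = jacobian u x := by
  have : ∀ᵐ x ∂(volume.restrict Ω), ∀ i j, Du x i j = jacobian u x i j := by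
    rw [ae_all_iff]; intro i
    rw [ae_all_iff]; intro j
    have hui : ContDiffOn ℝ 1 (fun x => u x i) Ω :=
      (EuclideanSpace.proj (𝕜 := ℝ) i).contDiff.comp_contDiffOn hu
    exact (hDu i j).ae_eq hΩ (isWeakPartialDeriv_of_contDiffOn hΩ hui j)
  filter_upwards [this] with x hx
  ext i j
  exact hx i j

/-- Contracting the cofactor matrix of `Du` with the gradient of `φ ∘ u`. -/
theorem sum_cof_mul_partialDeriv_comp {u : EuclideanSpace ℝ (Fin n) → EuclideanSpace ℝ (Fin n)}
    {φ : EuclideanSpace ℝ (Fin n) → ℝ} {x : EuclideanSpace ℝ (Fin n)}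
    (hu : DifferentiableAt ℝ u x) (hφ : DifferentiableAt ℝ φ (u x)) (i : Fin n) :
    ∑ j, cof (jacobian u x) i j * partialDeriv j (fun y => φ (u y)) x
      = (jacobian u x).det * partialDeriv i φ (u x) := by
  have h1 : ∀ j, partialDeriv j (fun y => φ (u y)) x
      = ∑ k, jacobian u x k j * partialDeriv k φ (u x) := by
    intro j
    have h2 : HasFDerivAt (fun y => φ (u y)) _ x := hφ.hasFDerivAt.comp x hu.hasFDerivAt
    have h3 : fderiv ℝ u x (EuclideanSpace.single j 1)
        = ∑ k, jacobian u x k j • EuclideanSpace.single k (1 : ℝ) := by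
      ext k
      rw [← jacobian_apply_of_differentiableAt hu]
      simp [Pi.single_apply]
    rw [partialDeriv, h2.fderiv, ContinuousLinearMap.comp_apply, h3, map_sum]
    simp [partialDeriv]
  have h4 := fun k => congrFun (congrFun (cof_mul_transpose (jacobian u x)) i) k
  simp only [Matrix.mul_apply, Matrix.transpose_apply, Matrix.smul_apply, Matrix.one_apply,
    smul_eq_mul] at h4
  simp_rw [h1, Finset.mul_sum]
  rw [Finset.sum_comm]
  simp_rw [← mul_assoc, ← Finset.sum_mul, h4]
  simp

/-- The pull-back by a `C¹` map, injective on `U`, of a test function supported in `u '' U`. -/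
theorem contDiff_indicator_comp {u : EuclideanSpace ℝ (Fin n) → EuclideanSpace ℝ (Fin n)}
    {U K : Set (EuclideanSpace ℝ (Fin n))} (hU : IsOpen U) (hu : ContDiffOn ℝ 1 u U)
    {φ : EuclideanSpace ℝ (Fin n) → ℝ} (hφ : ContDiff ℝ 1 φ) (hK : IsCompact K)
    (hUK : ∀ x ∈ U, u x ∈ tsupport φ → x ∈ K) (hKU : K ⊆ U) :
    ContDiff ℝ 1 (U.indicator fun x => φ (u x)) ∧
      tsupport (U.indicator fun x => φ (u x)) ⊆ K := by
  have hz : ∀ x, x ∉ K → U.indicator (fun x => φ (u x)) x = 0 := by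
    intro x hx
    by_cases hxU : x ∈ U
    · rw [Set.indicator_of_mem hxU]
      exact image_eq_zero_of_notMem_tsupport fun h => hx (hUK x hxU h)
    · exact Set.indicator_of_notMem hxU _
  refine ⟨contDiff_iff_contDiffAt.2 fun x => ?_, closure_minimal (fun x hx => ?_) hK.isClosed⟩
  -- Near a point of `K` the extension is `φ ∘ u`; near a point off `K` it is zero.
  · by_cases hx : x ∈ K
    · have hxU := hU.mem_nhds (hKU hx)
      have h1 : ContDiffAt ℝ 1 (fun x => φ (u x)) x :=
        hφ.contDiffAt.comp x (hu.contDiffAt hxU)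
      refine h1.congr_of_eventuallyEq ?_
      filter_upwards [hxU] with y hy
      exact Set.indicator_of_mem hy _
    · refine (contDiffAt_const (c := (0 : ℝ))).congr_of_eventuallyEq ?_
      filter_upwards [hK.isClosed.isOpen_compl.mem_nhds hx] with y hy
      exact hz y hy
  · by_contra h
    exact hx (hz x h)

/-- For a `C¹` solution `h(det Du)` is locally constant where `det Du ≠ 0`. -/
theorem IsWeakSolution.eventually_comp_det_eq {Ω : Set (EuclideanSpace ℝ (Fin n))}
    (hΩ : IsOpen Ω) {h : ℝ → ℝ} (hh : Continuous h)
    {u : EuclideanSpace ℝ (Fin n) → EuclideanSpace ℝ (Fin n)}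
    {Du : EuclideanSpace ℝ (Fin n) → Matrix (Fin n) (Fin n) ℝ} (hu : IsWeakSolution Ω h u Du)
    (huC : ContDiffOn ℝ 1 u Ω) {x₀ : EuclideanSpace ℝ (Fin n)} (hx₀ : x₀ ∈ Ω)
    (hdet : (jacobian u x₀).det ≠ 0) :
    ∃ c, ∀ᶠ x in 𝓝 x₀, h (jacobian u x).det = c := by
  set d : EuclideanSpace ℝ (Fin n) → ℝ := fun x => (jacobian u x).det with hd
  have hdc : ContinuousOn d Ω :=
    (Continuous.matrix_det (A := fun A : Matrix (Fin n) (Fin n) ℝ => A)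
      continuous_id).comp_continuousOn (continuousOn_jacobian hΩ huC)
  have hdiff : ∀ x ∈ Ω, DifferentiableAt ℝ u x := fun x hx =>
    (huC.contDiffAt (hΩ.mem_nhds hx)).differentiableAt (by simp)
  have hdet' : (fderiv ℝ u x₀).det ≠ 0 := by
    rwa [det_fderiv_eq_det_jacobian (hdiff x₀ hx₀)]
  let L := (fderiv ℝ u x₀).toContinuousLinearEquivOfDetNeZero hdet'
  have hL : HasFDerivAt u (L : EuclideanSpace ℝ (Fin n) →L[ℝ] EuclideanSpace ℝ (Fin n)) x₀ := by
    rw [ContinuousLinearMap.coe_toContinuousLinearEquivOfDetNeZero]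
    exact (hdiff x₀ hx₀).hasFDerivAt
  have hCx₀ : ContDiffAt ℝ 1 u x₀ := huC.contDiffAt (hΩ.mem_nhds hx₀)
  let e := hCx₀.toOpenPartialHomeomorph u hL (by simp)
  -- Here the determinant keeps the sign it has at `x₀`, so it differs from the `|det|` of the
  -- change of variables by a constant factor.
  set W : Set (EuclideanSpace ℝ (Fin n)) := Ω ∩ d ⁻¹' {t | 0 < t * d x₀} with hW
  have hWo : IsOpen W := hdc.isOpen_inter_preimage hΩ
    (isOpen_lt continuous_const (continuous_id.mul continuous_const))
  set U := e.source ∩ W with hUdef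
  have hUo : IsOpen U := e.open_source.inter hWo
  have hUΩ : U ⊆ Ω := fun x hx => hx.2.1
  have hx₀U : x₀ ∈ U :=
    ⟨hCx₀.mem_toOpenPartialHomeomorph_source hL (by simp), hx₀, mul_self_pos.2 hdet⟩
  have hsign : ∀ x ∈ U, d x = SignType.sign (d x₀) * |d x| := by
    intro x hx
    have h1 : 0 < d x * d x₀ := hx.2.2
    rcases lt_or_gt_of_ne hdet with h0 | h0
    · rw [sign_neg h0, abs_of_neg (by nlinarith)]; simp
    · rw [sign_pos h0, abs_of_pos (by nlinarith)]; simp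
  set V := u '' U with hV
  have hVo : IsOpen V := e.isOpen_image_of_subset_source hUo Set.inter_subset_left
  have hVt : V ⊆ e.target := by
    rintro _ ⟨x, hx, rfl⟩
    exact e.map_source hx.1
  have hsymm : ∀ y ∈ V, e.symm y ∈ U := by
    rintro _ ⟨x, hx, rfl⟩
    have : e.symm (u x) = x := e.left_inv hx.1
    rwa [this]
  -- The function `h(det Du)` in the target coordinates; the equation says that its weak gradient is
  -- zero.
  set g : EuclideanSpace ℝ (Fin n) → ℝ := fun y => h (d (e.symm y)) with hg
  have hgu : ∀ x ∈ U, g (u x) = h (d x) := by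
    intro x hx
    have : e.symm (u x) = x := e.left_inv hx.1
    simp only [hg, this]
  have hgc : ContinuousOn g V :=
    hh.comp_continuousOn ((hdc.mono hUΩ).comp (e.continuousOn_symm.mono hVt) hsymm)
  have hinj : Set.InjOn u U := e.injOn.mono Set.inter_subset_left
  have hweak : ∀ i, IsWeakPartialDeriv V i g fun _ => 0 := by
    intro i
    refine ⟨memLpLoc_of_continuousOn hgc, memLpLoc_of_continuousOn continuousOn_const, ?_⟩
    intro φ hφ hc hs
    have hφ1 : ContDiff ℝ 1 φ := hφ.of_le (by simp)
    simp only [zero_mul, integral_zero, neg_zero]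
    set K := e.symm '' tsupport φ with hKdef
    have hK : IsCompact K :=
      hc.isCompact.image_of_continuousOn (e.continuousOn_symm.mono (hs.trans hVt))
    have hKU : K ⊆ U := by
      rintro _ ⟨y, hy, rfl⟩
      exact hsymm y (hs hy)
    have hUK : ∀ x ∈ U, u x ∈ tsupport φ → x ∈ K := fun x hx hux =>
      ⟨u x, hux, e.left_inv hx.1⟩
    obtain ⟨hζ, hζK⟩ := contDiff_indicator_comp hUo (huC.mono hUΩ) hφ1 hK hUK hKU
    set ζ := U.indicator fun x => φ (u x) with hζdef
    have hmain := hu.integral_component_eq_zero i hζ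
      (hK.of_isClosed_subset (isClosed_tsupport _) hζK) (hζK.trans (hKU.trans hUΩ))
    have e1 : ∫ x in Ω, h (Du x).det * ∑ j, cof (Du x) i j * partialDeriv j ζ x
        = ∫ x in Ω, h (d x) * ∑ j, cof (jacobian u x) i j * partialDeriv j ζ x := by
      refine integral_congr_ae ?_
      filter_upwards [hu.isWeakJacobian.ae_eq_jacobian hΩ huC] with x hx
      rw [hx]
    have hζ0 : ∀ x, x ∉ U → ∀ j, partialDeriv j ζ x = 0 := fun x hx j =>
      partialDeriv_eq_zero_of_notMem_tsupport (fun h' => hx (hKU (hζK h'))) j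
    rw [e1, setIntegral_eq_of_subset_of_forall_sdiff_eq_zero hΩ.measurableSet hUΩ
      fun x hx => by simp [hζ0 x hx.2]] at hmain
    have e2 : ∫ x in U, h (d x) * ∑ j, cof (jacobian u x) i j * partialDeriv j ζ x
        = SignType.sign (d x₀) *
          ∫ x in U, |(fderiv ℝ u x).det| • (g (u x) * partialDeriv i φ (u x)) := by
      rw [← integral_const_mul]
      refine setIntegral_congr_fun hUo.measurableSet fun x hx => ?_
      have hpd : ∀ j, partialDeriv j ζ x = partialDeriv j (fun y => φ (u y)) x := by
        intro j
        rw [partialDeriv, partialDeriv]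
        congr 1
        refine Filter.EventuallyEq.fderiv_eq ?_
        filter_upwards [hUo.mem_nhds hx] with y hy
        exact Set.indicator_of_mem hy _
      simp only [hpd]
      rw [sum_cof_mul_partialDeriv_comp (hdiff x (hUΩ hx)) (hφ1.differentiable (by simp) _),
        det_fderiv_eq_det_jacobian (hdiff x (hUΩ hx)), hgu x hx]
      have := hsign x hx
      simp only [smul_eq_mul]
      calc h (d x) * (d x * partialDeriv i φ (u x))
          = h (d x) * ((SignType.sign (d x₀) * |d x|) * partialDeriv i φ (u x)) := by rw [← this]
        _ = _ := by ring
    rw [e2, ← integral_image_eq_integral_abs_det_fderiv_smul volume hUo.measurableSet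
      (fun x hx => (hdiff x (hUΩ hx)).hasFDerivAt.hasFDerivWithinAt) hinj
      fun y => g y * partialDeriv i φ y] at hmain
    refine (mul_eq_zero.1 hmain).resolve_left ?_
    rcases lt_or_gt_of_ne hdet with h0 | h0
    · rw [sign_neg h0]; simp
    · rw [sign_pos h0]; simp
  have hy₀ : u x₀ ∈ V := ⟨x₀, hx₀U, rfl⟩
  obtain ⟨r, hr, hrV, c, hcae⟩ :=
    exists_ae_eq_const_ball hVo (memLpLoc_of_continuousOn hgc) hweak hy₀
  -- Continuity upgrades equality almost everywhere to equality on the whole ball.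
  have hcB : Set.EqOn g (fun _ => c) (Metric.ball (u x₀) r) :=
    Measure.eqOn_open_of_ae_eq hcae Metric.isOpen_ball (hgc.mono hrV) continuousOn_const
  refine ⟨c, ?_⟩
  filter_upwards [hUo.mem_nhds hx₀U,
    (hdiff x₀ hx₀).continuousAt.preimage_mem_nhds (Metric.ball_mem_nhds _ hr)] with x hxU hxB
  rw [← hgu x hxU]
  exact hcB hxB

/-- A continuous function on a preconnected set is constant if its composition with a function
that is not constant on any interval is. -/
theorem eq_of_comp_eq_const {X : Type*} [TopologicalSpace X] {S : Set X} (hS : IsPreconnected S)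
    {d : X → ℝ} (hd : ContinuousOn d S) {h : ℝ → ℝ} {c : ℝ} (hc : ∀ x ∈ S, h (d x) = c)
    (hnc : ∀ a b : ℝ, a < b → ¬ ∃ c : ℝ, ∀ t ∈ Set.Ioo a b, h t = c) {x y : X} (hx : x ∈ S)
    (hy : y ∈ S) : d x = d y := by
  have hle : ∀ x ∈ S, ∀ y ∈ S, d y ≤ d x := by
    intro x hx y hy
    by_contra! hlt
    refine hnc _ _ hlt ⟨c, fun t ht => ?_⟩
    obtain ⟨z, hz, rfl⟩ := hS.intermediate_value hx hy hd (Set.Ioo_subset_Icc_self ht)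
    exact hc z hz
  exact le_antisymm (hle y hy x hx) (hle x hx y hy)

/-- A continuous function on a connected set is constant if it is locally constant away from its
zeros. -/
theorem exists_eq_const_of_locally_const {X : Type*} [TopologicalSpace X] {S : Set X}
    (hS : IsPreconnected S) {d : X → ℝ} (hd : ContinuousOn d S)
    (hloc : ∀ x ∈ S, d x ≠ 0 → ∀ᶠ y in 𝓝[S] x, d y = d x) : ∃ c, ∀ x ∈ S, d x = c := by
  by_cases hall : ∀ x ∈ S, d x = 0
  · exact ⟨0, hall⟩
  push Not at hall
  obtain ⟨x₁, hx₁, hne⟩ := hall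
  refine ⟨d x₁, fun x hx => ?_⟩
  have : PreconnectedSpace S := Subtype.preconnectedSpace hS
  -- The chosen value is nonzero, so every point of this level set is covered by the local
  -- hypothesis.
  have hclopen : IsClopen {y : S | d y = d x₁} := by
    refine ⟨isClosed_eq (continuousOn_iff_continuous_domRestrict.1 hd) continuous_const, ?_⟩
    rw [isOpen_iff_mem_nhds]
    intro y hy
    have hy' : d y = d x₁ := hy
    have h1 := hloc y y.2 (by rwa [hy'])
    rw [← map_nhds_subtype_val] at h1
    filter_upwards [h1] with z hz
    exact hz.trans hy'
  have huniv := hclopen.eq_univ ⟨⟨x₁, hx₁⟩, rfl⟩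
  have : (⟨x, hx⟩ : S) ∈ {y : S | d y = d x₁} := huniv ▸ Set.mem_univ _
  exact this

/-- If `h` is not constant on any interval, then `det Du` is constant for every `C¹` solution. -/
theorem IsWeakSolution.exists_ae_det_eq_of_contDiffOn {Ω : Set (EuclideanSpace ℝ (Fin n))}
    (hΩ : IsOpen Ω) (hconn : IsPreconnected Ω) {h : ℝ → ℝ} (hh : Continuous h)
    {u : EuclideanSpace ℝ (Fin n) → EuclideanSpace ℝ (Fin n)}
    {Du : EuclideanSpace ℝ (Fin n) → Matrix (Fin n) (Fin n) ℝ} (hu : IsWeakSolution Ω h u Du)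
    (huC : ContDiffOn ℝ 1 u Ω)
    (hnc : ∀ a b : ℝ, a < b → ¬ ∃ c : ℝ, ∀ t ∈ Set.Ioo a b, h t = c) :
    ∃ c : ℝ, ∀ᵐ x ∂(volume.restrict Ω), (Du x).det = c := by
  have hdc : ContinuousOn (fun x => (jacobian u x).det) Ω :=
    (Continuous.matrix_det (A := fun A : Matrix (Fin n) (Fin n) ℝ => A)
      continuous_id).comp_continuousOn (continuousOn_jacobian hΩ huC)
  obtain ⟨c, hc⟩ := exists_eq_const_of_locally_const hconn hdc fun x hx hne => by
    obtain ⟨c, hc⟩ := hu.eventually_comp_det_eq hΩ hh huC hx hne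
    -- A ball supplies the connected neighbourhood on which the intermediate value argument runs.
    obtain ⟨r, hr, hball⟩ := Metric.mem_nhds_iff.1 (inter_mem hc (hΩ.mem_nhds hx))
    filter_upwards [mem_nhdsWithin_of_mem_nhds (Metric.ball_mem_nhds x hr)] with y hy
    exact eq_of_comp_eq_const (convex_ball x r).isPreconnected
      (hdc.mono fun z hz => (hball hz).2) (fun z hz => (hball hz).1) hnc hy
      (Metric.mem_ball_self hr)
  refine ⟨c, ?_⟩
  filter_upwards [hu.isWeakJacobian.ae_eq_jacobian hΩ huC, ae_restrict_mem hΩ.measurableSet]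
    with x hx hxΩ
  rw [hx]
  exact hc x hxΩ

end SmoothCase

end DetEL

theorem corollary2p6 (n : ℕ) (hn : 2 ≤ n)
    (Ω : Set (EuclideanSpace ℝ (Fin n)))
    (hΩ_open : IsOpen Ω) (hΩ_conn : IsConnected Ω) (hΩ_bdd : Bornology.IsBounded Ω)
    (h : ℝ → ℝ) (hh : Continuous h)
    (u : EuclideanSpace ℝ (Fin n) → EuclideanSpace ℝ (Fin n))
    (Du : EuclideanSpace ℝ (Fin n) → Matrix (Fin n) (Fin n) ℝ)
    (hu : DetEL.IsWeakSolution Ω h u Du)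
    (hcases :
      (ContDiffOn ℝ 1 u Ω ∧
        ∀ a b : ℝ, a < b → ¬ ∃ c : ℝ, ∀ t ∈ Set.Ioo a b, h t = c) ∨
      (∃ p : ℝ≥0∞, (n : ℝ≥0∞) - 1 ≤ p ∧
        DetEL.MemW1LocVec Ω p u ∧
        DetEL.MemW1Loc Ω (DetEL.pBar n p) (fun x => h (Du x).det) ∧
        Function.Injective h)) :
    ∃ c : ℝ, ∀ᵐ x ∂(volume.restrict Ω), (Du x).det = c := by
  rcases hcases with ⟨huC, hnc⟩ | ⟨p, hp, hup, hhp, hinj⟩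
  · exact hu.exists_ae_det_eq_of_contDiffOn hΩ_open hΩ_conn.isPreconnected hh huC hnc
  · exact hu.exists_ae_det_eq_of_injective hn hΩ_open hΩ_conn hp hup hhp hinj
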